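/- Let $d \in \mathbb{N} \cup \{\infty\}$ and let $\mathbb{H}^2_d$ be the full Fock space of all power series $h = \sum_\omega \hat h_\omega \mathfrak{z}^\omega$ in $d$ non-commuting variables with $\sum_\omega |\hat h_\omega|^2 < \infty$, where $\omega$ runs over the words in the letters $1, \dots, d$. Inner products are conjugate-linear in the first argument. Let $L_k$ be left multiplication by $\mathfrak{z}_k$ and let $\mathbb{H}^\infty_d$ be the algebra of left multipliers, i.e. of the power series $F$ for which $F(L) : h \mapsto F h$ is a bounded operator on $\mathbb{H}^2_d$. For $F = \sum_\omega \hat F_\omega \mathfrak{z}^\omega \in \mathbb{H}^\infty_d$ put $F(0) = \hat F_\emptyset$, $F^{\mathrm t} = \sum_\omega \hat F_\omega \mathfrak{z}^{\omega^{\mathrm t}}$, where $\omega^{\mathrm t}$ is $\omega$ with its letters reversed, and let $F(R) : h \mapsto h F^{\mathrm t}$; $F$ is contractive if $\|F(L)\| = \|F(R)\| \le 1$, and outer if $F(R)$ has dense range. For a finite column $c$ of elements of $\mathbb{H}^\infty_d$, the operators $c(L), c(R) : \mathbb{H}^2_d \to \mathbb{H}^2_d \otimes \mathbb{C}^n$ and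 $c^{\mathrm t}$ are defined entrywise. A contractive multiplier (or column) $c$ is column-extreme (CE) if the only multiplier (column of the same size) $f$ for which $\left(\begin{smallmatrix} c \\ f \end{smallmatrix}\right)$ is contractive is $f = 0$. For contractive $c$, let $\mathscr{H}^{\mathrm t}(c)$ be the range of $\sqrt{I - c(R) c(R)^*}$ with the Hilbert space norm $\|\cdot\|_c$ that makes this operator a co-isometry onto its range, and let $\boldsymbol{c} = (L_k^* \otimes I\, c^{\mathrm t})_{k} \in \mathscr{H}^{\mathrm t}(c) \otimes \mathbb{C}^d$, with the norm, again written $\|\cdot\|_c$, of this Hilbert space. A bounded operator on $\mathbb{H}^2_d$ is factorizable if it equals $f(R)^* f(R)$ for some $f \in \mathbb{H}^\infty_d$; the maximal factorizable minorant of $T \ge 0$ is the greatest factorizable operator $T_0 \le T$. Let $b \in \mathbb{H}^\infty_d$ be contractive and not column-extreme. Then $L_k^*$ restricts to a bounded operator $X_k$ on $\mathscr{H}^{\mathrm t}(b)$, $b^{\mathrm t} \in \mathscr{H}^{\mathrm t}(b)$, $1 - |b(0)|^2 - \|\boldsymbol{b}\|_b^2 > 0$, and there is a unique $a \in \mathbb{H}^\infty_d$,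 the NC Sarason function of $b$, with $$ a(0) = \sqrt{1 - |b(0)|^2 - \|\boldsymbol{b}\|_b^2}, \qquad \hat a_\omega = -a(0)\, \langle b^{\mathrm t}, X^\omega b^{\mathrm t} \rangle_b \quad (\omega \neq \emptyset), $$ where $X^\omega = X_{i_1} \cdots X_{i_n}$ for $\omega = i_1 \cdots i_n$. Moreover, $a$ is contractive and has the following properties. 1. $a$ is outer and $a(R)^* a(R)$ is the maximal factorizable minorant of $I - b(R)^* b(R)$. 2. $a(0)^2 = \inf_p \langle 1 - p, (I - b(R)^* b(R))(1 - p) \rangle_{\mathbb{H}^2_d}$, the infimum being over all free polynomials $p$ in $\mathfrak{z}_1, \mathfrak{z}_2, \dots$ with $p(0) = 0$. 3. The column $c = \left(\begin{smallmatrix} b \\ a \end{smallmatrix}\right)$ is contractive and column-extreme, and $\|\boldsymbol{c}\|_c = \|\boldsymbol{b}\|_b$. -/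

import Mathlib

open scoped InnerProductSpace InnerProduct

noncomputable section

namespace FreeSarason

/-! ### Operator-range spaces and complementary spaces -/

section OperatorRange

variable {K H : Type*} [NormedAddCommGroup K] [InnerProductSpace ℂ K] [CompleteSpace K]
  [NormedAddCommGroup H] [InnerProductSpace ℂ H]

/-- The operator-range space `𝓜(A)`: as a vector space it is `Ran A`; its inner product, defined
below, is the one for which `A` is a co-isometry onto its range. -/
def OperatorRange (A : K →L[ℂ] H) : Type _ := LinearMap.range (A : K →ₗ[ℂ] H)

namespace OperatorRange

variable (A : K →L[ℂ] H)

instance : AddCommGroup (OperatorRange A) :=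
  inferInstanceAs (AddCommGroup (LinearMap.range (A : K →ₗ[ℂ] H)))

instance : Module ℂ (OperatorRange A) :=
  inferInstanceAs (Module ℂ (LinearMap.range (A : K →ₗ[ℂ] H)))

/-- The inclusion `𝓜(A) ⊆ H`. -/
def incl : OperatorRange A →ₗ[ℂ] H := (LinearMap.range (A : K →ₗ[ℂ] H)).subtype

theorem isCompl_ker :
    IsCompl (LinearMap.ker (A : K →ₗ[ℂ] H))ᗮ (LinearMap.ker (A : K →ₗ[ℂ] H)) := by
  have : CompleteSpace (LinearMap.ker (A : K →ₗ[ℂ] H)) :=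
    (ContinuousLinearMap.isClosed_ker A).completeSpace_coe
  exact (Submodule.isCompl_orthogonal _).symm

/-- `A` restricts to a linear isomorphism of `(ker A)ᗮ` onto `𝓜(A)`. -/
def kerPerpEquiv : (LinearMap.ker (A : K →ₗ[ℂ] H))ᗮ ≃ₗ[ℂ] OperatorRange A :=
  LinearMap.kerComplementEquivRange (A : K →ₗ[ℂ] H) (isCompl_ker A)

theorem incl_kerPerpEquiv (x : (LinearMap.ker (A : K →ₗ[ℂ] H))ᗮ) :
    incl A (kerPerpEquiv A x) = A x := rfl

instance : NormedAddCommGroup (OperatorRange A) :=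
  NormedAddCommGroup.induced (OperatorRange A) (LinearMap.ker (A : K →ₗ[ℂ] H))ᗮ
    (kerPerpEquiv A).symm.toLinearMap (kerPerpEquiv A).symm.injective

instance : InnerProductSpace ℂ (OperatorRange A) where
  norm_smul_le c x := by
    change ‖(kerPerpEquiv A).symm (c • x)‖ ≤ ‖c‖ * ‖(kerPerpEquiv A).symm x‖
    rw [map_smul, norm_smul]
  inner x y := inner ℂ ((kerPerpEquiv A).symm x) ((kerPerpEquiv A).symm y)
  norm_sq_eq_re_inner x := norm_sq_eq_re_inner (𝕜 := ℂ) ((kerPerpEquiv A).symm x)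
  conj_inner_symm x y := inner_conj_symm _ _
  add_left x y z := by
    simp only [map_add, inner_add_left]
  smul_left x y c := by
    simp only [map_smul, inner_smul_left]

/-- `A` maps `(ker A)ᗮ` isometrically onto `𝓜(A)`, i.e. `A : K → 𝓜(A)` is a co-isometry. -/
theorem inner_kerPerpEquiv (x y : (LinearMap.ker (A : K →ₗ[ℂ] H))ᗮ) :
    inner ℂ (kerPerpEquiv A x) (kerPerpEquiv A y) = inner ℂ (x : K) (y : K) := by
  change inner ℂ ((kerPerpEquiv A).symm (kerPerpEquiv A x))
    ((kerPerpEquiv A).symm (kerPerpEquiv A y)) = _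
  simp

end OperatorRange

/-- The complementary space `𝓜(√(I - T T*))` of a contraction `T`. -/
abbrev ComplementarySpace [CompleteSpace H] (T : K →L[ℂ] H) : Type _ :=
  OperatorRange (CFC.sqrt (1 - T ∘L T†) : H →L[ℂ] H)

end OperatorRange

/-! ### The full Fock space -/

variable {ι : Type*}

/-- The full Fock space (free Hardy space) over the letters `ι`: square-summable power series
`∑ h_ω z^ω`, where `ω` runs over the words in `ι`. -/
abbrev Fock (ι : Type*) : Type _ := lp (fun _ : List ι => ℂ) 2

/-- Product of formal power series in the non-commuting variables `z_i`, `i : ι`: the coefficient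
of `z^ω` is the sum of `f_α g_β` over all factorizations `ω = αβ`. -/
def ncMul (f g : List ι → ℂ) (w : List ι) : ℂ :=
  ∑ n ∈ Finset.range (w.length + 1), f (w.take n) * g (w.drop n)

open Classical in
/-- The vacuum vector `1 = z^∅`. -/
def vacuum (ι : Type*) : Fock ι := lp.single 2 ([] : List ι) (1 : ℂ)

theorem memlp_comp {φ : List ι → List ι} (hφ : Function.Injective φ) (h : Fock ι) :
    Memℓp (fun w => h (φ w)) 2 := by
  have h2 : 0 < (2 : ENNReal).toReal := by norm_num
  exact memℓp_gen (((lp.memℓp h).summable h2).comp_injective hφ)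

/-- The contraction `h ↦ (h_{φ(ω)})_ω` on Fock space, for an injective `φ`. -/
def compOp (φ : List ι → List ι) (hφ : Function.Injective φ) : Fock ι →L[ℂ] Fock ι :=
  LinearMap.mkContinuous
    { toFun := fun h => ⟨fun w => h (φ w), memlp_comp hφ h⟩
      map_add' := fun _ _ => rfl
      map_smul' := fun _ _ => rfl } 1 (by
    intro h
    have h2 : 0 < (2 : ENNReal).toReal := by norm_num
    rw [one_mul]
    refine lp.norm_le_of_tsum_le h2 (norm_nonneg h) ?_
    rw [lp.norm_rpow_eq_tsum h2 h]
    exact tsum_comp_le_tsum_of_inj ((lp.memℓp h).summable h2) (fun _ => by positivity) hφ)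

theorem compOp_apply (φ : List ι → List ι) (hφ : Function.Injective φ) (h : Fock ι)
    (w : List ι) : compOp φ hφ h w = h (φ w) := rfl

/-- The letter reversal `U_t`, `z^ω ↦ z^{ω^t}`. -/
def flip : Fock ι →L[ℂ] Fock ι := compOp List.reverse List.reverse_injective

/-- The left free shift `L_k`, multiplication by `z_k` from the left (see `leftShift_apply`). It is
introduced as the adjoint of `h ↦ (h_{kω})_ω`. -/
def leftShift (k : ι) : Fock ι →L[ℂ] Fock ι :=
  (compOp (fun w => k :: w) (List.cons_injective))†

theorem adjoint_leftShift_apply (k : ι) (h : Fock ι) (w : List ι) :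
    ((leftShift k)†) h w = h (k :: w) := by
  rw [leftShift, ContinuousLinearMap.adjoint_adjoint]
  rfl

open Classical in
theorem leftShift_apply (k : ι) (h : Fock ι) (w : List ι) :
    (leftShift k h) w = ncMul (Pi.single [k] 1) h w := by
  have key : (leftShift k h) w =
      inner ℂ (compOp (fun w => k :: w) List.cons_injective (lp.single 2 w (1 : ℂ))) h := by
    rw [leftShift, ← ContinuousLinearMap.adjoint_inner_right, lp.inner_single_left]
    simp
  rw [key]
  cases w with
  | nil =>
    have : compOp (fun w => k :: w) List.cons_injective (lp.single 2 ([] : List ι) (1 : ℂ))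
        = 0 := by
      apply lp.ext
      funext v
      rw [compOp_apply, lp.single_apply]
      simp
    rw [this]
    simp [ncMul]
  | cons j v =>
    have hs : ncMul (Pi.single [k] 1) h (j :: v) = if j = k then h v else 0 := by
      rw [ncMul, Finset.sum_eq_single 1]
      · by_cases hjk : j = k
        · simp [hjk]
        · have : ([j] : List ι) ≠ [k] := by simpa using hjk
          simp [hjk]
      · intro n hn h1
        have : (j :: v).take n ≠ [k] := by
          intro hh
          have := congrArg List.length hh
          simp only [List.length_take, List.length_cons, List.length_nil] at this
          simp only [Finset.mem_range, List.length_cons] at hn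
          omega
        simp [this]
      · intro hh
        simp at hh
    rw [hs]
    by_cases hjk : j = k
    · subst hjk
      have : compOp (fun w => j :: w) List.cons_injective (lp.single 2 (j :: v) (1 : ℂ))
          = lp.single 2 v (1 : ℂ) := by
        apply lp.ext
        funext u
        rw [compOp_apply, lp.single_apply, lp.single_apply]
        simp [Pi.single_apply]
      rw [this, lp.inner_single_left]
      simp
    · have : compOp (fun w => k :: w) List.cons_injective (lp.single 2 (j :: v) (1 : ℂ))
          = 0 := by
        apply lp.ext
        funext u
        rw [compOp_apply, lp.single_apply]
        simp [Ne.symm hjk]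
      rw [this]
      simp [hjk]

/-! ### The free Hardy algebra and column multipliers -/

/-- The free Hardy algebra `ℍ^∞`, i.e. the left multiplier algebra of Fock space: formal power
series `F` for which `F(L) : h ↦ F h` is a bounded operator on Fock space. The operator is
determined by the series. -/
structure Hinf (ι : Type*) where
  /-- the Taylor coefficients `F̂_ω` -/
  coeff : List ι → ℂ
  /-- the operator `F(L)` -/
  opL : Fock ι →L[ℂ] Fock ι
  opL_apply : ∀ (h : Fock ι) (w : List ι), opL h w = ncMul coeff h w

namespace Hinf

/-- `F(R) = U_t F(L) U_t`, right multiplication by `F^t` (see `opR_apply`). -/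
def opR (F : Hinf ι) : Fock ι →L[ℂ] Fock ι := flip ∘L F.opL ∘L flip

theorem opR_apply (F : Hinf ι) (h : Fock ι) (w : List ι) :
    F.opR h w = ncMul h (fun v => F.coeff v.reverse) w := by
  change F.opL (flip h) w.reverse = _
  rw [F.opL_apply, ncMul, ncMul, ← Finset.sum_range_reflect, List.length_reverse]
  refine Finset.sum_congr rfl fun n hn => ?_
  rw [Finset.mem_range] at hn
  have e : w.length + 1 - 1 - n = w.length - n := by omega
  change _ * h (List.reverse _) = _
  rw [e, List.drop_reverse, List.take_reverse, List.reverse_reverse, mul_comm]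
  have e2 : w.length - (w.length - n) = n := by omega
  rw [e2]

/-- The vector `F^t = F(R) 1` of Fock space, `F^t = ∑ F̂_ω z^{ω^t}`. -/
def transpose (F : Hinf ι) : Fock ι := F.opR (vacuum ι)

theorem transpose_apply (F : Hinf ι) (w : List ι) : F.transpose w = F.coeff w.reverse := by
  classical
  rw [transpose, opR_apply, ncMul, Finset.sum_eq_single 0]
  · simp [vacuum, lp.single_apply]
  · intro n hn h0
    have : w.take n ≠ [] := by
      intro hh
      have := congrArg List.length hh
      simp only [List.length_take, List.length_nil] at this
      rw [Finset.mem_range] at hn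
      omega
    simp [vacuum, lp.single_apply, this]
  · intro hh
    simp at hh

/-- A multiplier is outer if it has dense range. -/
def IsOuter (F : Hinf ι) : Prop := DenseRange F.opR

end Hinf

/-- The column `h ↦ (T_j h)_j` from Fock space into the Hilbert space direct sum of copies of Fock
space. -/
def column {κ : Type*} [Fintype κ] (T : κ → Fock ι →L[ℂ] Fock ι) :
    Fock ι →L[ℂ] PiLp 2 (fun _ : κ => Fock ι) :=
  ((PiLp.continuousLinearEquiv 2 ℂ (fun _ : κ => Fock ι)).symm :
    (∀ _ : κ, Fock ι) →L[ℂ] PiLp 2 (fun _ : κ => Fock ι)) ∘L ContinuousLinearMap.pi T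

theorem column_apply {κ : Type*} [Fintype κ] (T : κ → Fock ι →L[ℂ] Fock ι) (h : Fock ι) (j : κ) :
    column T h j = T j h := rfl

/-- `c(L)` for a column `c` of multipliers. -/
def colL {κ : Type*} [Fintype κ] (c : κ → Hinf ι) : Fock ι →L[ℂ] PiLp 2 (fun _ : κ => Fock ι) :=
  column fun j => (c j).opL

/-- `c(R)` for a column `c` of multipliers. -/
def colR {κ : Type*} [Fintype κ] (c : κ → Hinf ι) : Fock ι →L[ℂ] PiLp 2 (fun _ : κ => Fock ι) :=
  column fun j => (c j).opR

/-- A contractive multiplier `b` is column-extreme if there is no non-zero multiplier `a` for which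
the column `(b; a)` is contractive. -/
def IsColumnExtreme (b : Hinf ι) : Prop :=
  ‖b.opL‖ ≤ 1 ∧ ∀ a : Hinf ι, ‖colL ![b, a]‖ ≤ 1 → ∀ w, a.coeff w = 0

/-- A contractive column `c` of multipliers is column-extreme if there is no non-zero column `a` of
the same size for which the column `(c; a)` is contractive. -/
def IsColumnExtremeCol {κ : Type*} [Fintype κ] (c : κ → Hinf ι) : Prop :=
  ‖colL c‖ ≤ 1 ∧
    ∀ a : κ → Hinf ι, ‖colL (Sum.elim c a)‖ ≤ 1 → ∀ j w, (a j).coeff w = 0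

/-! ### De Branges–Rovnyak spaces and the Sarason function -/

/-- The right free de Branges–Rovnyak space `𝓗^t(b) = 𝓜(√(I - b(R) b(R)*))`. -/
abbrev Ht (b : Hinf ι) : Type _ := ComplementarySpace b.opR

/-- The inclusion `𝓗^t(b) ⊆ ℍ²`. -/
abbrev Ht.incl (b : Hinf ι) : Ht b →ₗ[ℂ] Fock ι := OperatorRange.incl _

/-- The right free de Branges–Rovnyak space `𝓗^t(c) = 𝓜(√(I - c(R) c(R)*))` of a column. -/
abbrev HtCol {κ : Type*} [Fintype κ] (c : κ → Hinf ι) : Type _ := ComplementarySpace (colR c)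

/-- The inclusion `𝓗^t(c) ⊆ ℍ² ⊗ ℂ^κ`. -/
abbrev HtCol.incl {κ : Type*} [Fintype κ] (c : κ → Hinf ι) :
    HtCol c →ₗ[ℂ] PiLp 2 (fun _ : κ => Fock ι) := OperatorRange.incl _

/-- `𝐛 = L* b^t`, as an element of `𝓗^t(b) ⊗ ℂ^d` (the `ℓ²`-direct sum of copies of `𝓗^t(b)`
indexed by the letters). -/
def IsBackwardShift (b : Hinf ι) (bb : lp (fun _ : ι => Ht b) 2) : Prop :=
  ∀ k, Ht.incl b (bb k) = ((leftShift k)†) b.transpose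

/-- `𝐜 = (L* ⊗ I) c^t`, as an element of `𝓗^t(c) ⊗ ℂ^d`. -/
def IsBackwardShiftCol {κ : Type*} [Fintype κ] (c : κ → Hinf ι)
    (cc : lp (fun _ : ι => HtCol c) 2) : Prop :=
  ∀ k j, HtCol.incl c (cc k) j = ((leftShift k)†) (c j).transpose

/-- `a` is the Sarason function of `b`. With `X_k` the restriction of `L_k*` to `𝓗^t(b)`, with
`b^t ∈ 𝓗^t(b)` and `𝐛 = L* b^t ∈ 𝓗^t(b) ⊗ ℂ^d`, its Taylor coefficients are
`a(0) = √(1 - |b(0)|² - ‖𝐛‖²) > 0` and `â_ω = - a(0) ⟨b^t, X^ω b^t⟩` for `ω ≠ ∅`; the inner product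
is conjugate-linear in the first argument, and `X^ω = X_{i₁} ⋯ X_{iₙ}` for `ω = i₁ ⋯ iₙ`. -/
def IsSarasonFunction (b a : Hinf ι) : Prop :=
  ∃ (X : ι → Ht b →L[ℂ] Ht b) (bt : Ht b) (bb : lp (fun _ : ι => Ht b) 2),
    (∀ k f, Ht.incl b (X k f) = ((leftShift k)†) (Ht.incl b f)) ∧
    Ht.incl b bt = b.transpose ∧
    IsBackwardShift b bb ∧
    0 < 1 - ‖b.coeff []‖ ^ 2 - ‖bb‖ ^ 2 ∧
    a.coeff [] = (Real.sqrt (1 - ‖b.coeff []‖ ^ 2 - ‖bb‖ ^ 2) : ℂ) ∧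
    ∀ w, w ≠ [] → a.coeff w = -a.coeff [] * inner ℂ bt ((w.map X).prod bt)

/-! ### Factorizable minorants and free polynomials -/

/-- `T` is factorizable if `T = f(R)* f(R)` for some `f` in the free Hardy algebra. -/
def IsFactorizable (T : Fock ι →L[ℂ] Fock ι) : Prop :=
  ∃ f : Hinf ι, T = f.opR† ∘L f.opR

/-- `T₀` is the maximal factorizable minorant of `T`: the greatest factorizable operator below `T`
in the operator order. -/
def IsMaximalFactorizableMinorant (T T₀ : Fock ι →L[ℂ] Fock ι) : Prop :=
  IsGreatest {S | IsFactorizable S ∧ S ≤ T} T₀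

/-- Free polynomials, as vectors of Fock space. -/
def IsFreePolynomial (p : Fock ι) : Prop := {w : List ι | p w ≠ 0}.Finite

end FreeSarason

end

/-!
The residual of an operator `D` on the Fock space is the part of `D 1` orthogonal to the images
`D p` of the polynomials `p` with `p(0) = 0`. Let `D` have dense range and
`D† D = 1 - b(R)† b(R)`, and let `u` be its residual.

Since `D† D` is multi-Toeplitz, the left shifts induce through `D` a row isometry on the target of
`D`, and `u` is a wandering vector for it. Minimality of `‖u‖` is the variational formula
`‖u‖² = inf_p ‖D (1 - p)‖²`. Every `T` that commutes with the shifts and is dominated by `D` has a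
residual of norm at most `‖u‖`, and vanishes if its own residual does; as `b` is not
column-extreme, this gives `u ≠ 0`. Compressing `D` to the shift-invariant subspace generated by
`u` and identifying that subspace with the Fock space gives an operator commuting with the left
shifts, that is `a(R)` for a multiplier `a`: it is outer, has `a(0) = ‖u‖`, and is the largest
multiplier dominated by `D`.

An element `f` of `𝓗ᵗ(b)` has a unique partner `z` with `b(R)† f = D† z`, and inner products in
`𝓗ᵗ(b)` are sums of inner products of `f`s and of `z`s. The partner of `bᵗ` is `‖u‖⁻² u - D 1`, and
backward shifts act on partners as the adjoints of the row isometry, which turns the coefficients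
of `a` into `-a(0) ⟨bᵗ, X^ω bᵗ⟩`.

If `‖a(R) x‖² + ‖D' x‖² ≤ ‖D x‖²` for all `x`, then minimality of `‖u‖ = a(0)` forces the residual
of `D'` to vanish. For `D' = f(R)` this is column-extremality of `(b, a)`, and for a defect operator
`D'` of the column it is the equality of the norms of the backward shifts, since each of these is
determined by the constant terms and the residual.
-/

noncomputable section

namespace FreeSarason

theorem adjoint_prod_map {ι E : Type*} [NormedAddCommGroup E] [InnerProductSpace ℂ E]
    [CompleteSpace E] (V : ι → E →L[ℂ] E) (w : List ι) :
    (w.map V).prod† = (w.reverse.map fun k => (V k)†).prod := by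
  induction w with
  | nil => exact ContinuousLinearMap.adjoint_id
  | cons k w ih =>
    rw [List.map_cons, List.prod_cons, ContinuousLinearMap.mul_def,
      ContinuousLinearMap.adjoint_comp, ih, List.reverse_cons, List.map_append, List.prod_append,
      List.map_singleton, List.prod_singleton, ContinuousLinearMap.mul_def]

section Contractions

variable {E F G : Type*} [NormedAddCommGroup E] [InnerProductSpace ℂ E] [NormedAddCommGroup F]
  [InnerProductSpace ℂ F]

theorem opNorm_le_one_iff (T : E →L[ℂ] F) : ‖T‖ ≤ 1 ↔ ∀ x, ‖T x‖ ≤ ‖x‖ := by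
  simpa only [one_mul] using T.opNorm_le_iff zero_le_one

variable [CompleteSpace E] [CompleteSpace F] [NormedAddCommGroup G] [InnerProductSpace ℂ G]
  [CompleteSpace G]

theorem inner_adjoint_comp_self_apply (T : E →L[ℂ] F) (x : E) :
    ⟪x, (T† ∘L T) x⟫_ℂ = (‖T x‖ ^ 2 : ℝ) := by
  rw [ContinuousLinearMap.comp_apply, ContinuousLinearMap.adjoint_inner_right,
    inner_self_eq_norm_sq_to_K, Complex.ofReal_pow]
  rfl

theorem adjoint_comp_self_le_iff (S : E →L[ℂ] F) (T : E →L[ℂ] G) :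
    S† ∘L S ≤ T† ∘L T ↔ ∀ x, ‖S x‖ ≤ ‖T x‖ := by
  have hS := (ContinuousLinearMap.isPositive_adjoint_comp_self S).isSymmetric
  have hT := (ContinuousLinearMap.isPositive_adjoint_comp_self T).isSymmetric
  have re_inner (x : E) :
      RCLike.re ⟪x, (T† ∘L T - S† ∘L S) x⟫_ℂ = ‖T x‖ ^ 2 - ‖S x‖ ^ 2 := by
    rw [sub_apply, inner_sub_right, inner_adjoint_comp_self_apply,
      inner_adjoint_comp_self_apply, ← Complex.ofReal_sub]
    exact Complex.ofReal_re _
  rw [ContinuousLinearMap.le_def]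
  refine ⟨fun h x => ?_, fun h => ⟨hT.sub hS, fun x => ?_⟩⟩
  · have hx := h.re_inner_nonneg_right x
    rw [re_inner, sub_nonneg] at hx
    exact le_of_sq_le_sq hx (norm_nonneg _)
  · rw [ContinuousLinearMap.reApplyInnerSelf_apply, inner_re_symm, re_inner, sub_nonneg]
    gcongr
    exact h x

theorem one_sub_adjoint_comp_self_nonneg {T : E →L[ℂ] F} (hT : ‖T‖ ≤ 1) : 0 ≤ 1 - T† ∘L T := by
  have h := (adjoint_comp_self_le_iff T (.id ℂ E)).2 ((opNorm_le_one_iff T).1 hT)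
  rwa [ContinuousLinearMap.comp_id, ContinuousLinearMap.adjoint_id, ← sub_nonneg] at h

end Contractions

section DenseRange

variable {E F : Type*} [NormedAddCommGroup E] [InnerProductSpace ℂ E] [CompleteSpace E]
  [NormedAddCommGroup F] [InnerProductSpace ℂ F] [CompleteSpace F]

theorem denseRange_iff_adjoint_injective {D : E →L[ℂ] F} :
    DenseRange D ↔ Function.Injective (D†) := by
  have h : D.range.topologicalClosure = ⊤ ↔ D.rangeᗮ = ⊥ :=
    Submodule.topologicalClosure_eq_top_iff
  rw [D.orthogonal_range, LinearMap.ker_eq_bot,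
    ← Submodule.dense_iff_topologicalClosure_eq_top] at h
  exact h

/-- `A†` with its codomain restricted to `(ker A)ᗮ`, the closure of its range. -/
def adjointOnto (A : E →L[ℂ] F) : F →L[ℂ] A.kerᗮ := (A ∘L A.kerᗮ.subtypeL)†

theorem adjoint_adjointOnto_apply (A : E →L[ℂ] F) (x : A.kerᗮ) : ((adjointOnto A)†) x = A x := by
  rw [adjointOnto, ContinuousLinearMap.adjoint_adjoint]
  rfl

theorem coe_adjointOnto_apply (A : E →L[ℂ] F) (y : F) : (adjointOnto A y : E) = (A†) y := by
  have : CompleteSpace A.ker := A.isClosed_ker.completeSpace_coe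
  have hy : (A†) y ∈ A.kerᗮ := by
    rw [A.orthogonal_ker]
    exact Submodule.le_topologicalClosure _ ⟨y, rfl⟩
  rw [adjointOnto, ContinuousLinearMap.adjoint_comp, Submodule.adjoint_subtypeL]
  exact Submodule.starProjection_eq_self_iff.2 hy

theorem denseRange_adjointOnto (A : E →L[ℂ] F) : DenseRange (adjointOnto A) := by
  rw [denseRange_iff_adjoint_injective, injective_iff_map_eq_zero]
  intro x hx
  rw [adjoint_adjointOnto_apply] at hx
  exact Subtype.ext (inner_self_eq_zero.1 (x.2 (x : E) hx))

theorem adjoint_comp_self_adjointOnto (A : E →L[ℂ] F) :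
    (adjointOnto A)† ∘L adjointOnto A = A ∘L A† := by
  ext y
  rw [ContinuousLinearMap.comp_apply, adjoint_adjointOnto_apply, coe_adjointOnto_apply]
  rfl

end DenseRange

section DefectOperators

variable {E F M N : Type*} [NormedAddCommGroup E] [InnerProductSpace ℂ E] [CompleteSpace E]
  [NormedAddCommGroup F] [InnerProductSpace ℂ F] [CompleteSpace F]
  [NormedAddCommGroup M] [InnerProductSpace ℂ M] [CompleteSpace M]
  [NormedAddCommGroup N] [InnerProductSpace ℂ N] [CompleteSpace N]

/-- `D` is a defect operator of the contraction `T`. Up to a unitary operator on the left, it is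
`√(1 - T† T)` with its codomain restricted to the closure of the range. -/
structure IsDefect (T : E →L[ℂ] F) (D : E →L[ℂ] M) : Prop where
  denseRange : DenseRange D
  adjoint_comp_self : D† ∘L D = 1 - T† ∘L T

/-- The defect operator `√(1 - T† T)`, as a map onto a dense subspace of `(ker √(1 - T† T))ᗮ`. -/
def defect (T : E →L[ℂ] F) : E →L[ℂ] (CFC.sqrt (1 - T† ∘L T) : E →L[ℂ] E).kerᗮ :=
  adjointOnto (CFC.sqrt (1 - T† ∘L T))

theorem adjoint_comp_self_adjointOnto_sqrt {A : E →L[ℂ] E} (hA : 0 ≤ A) :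
    (adjointOnto (CFC.sqrt A))† ∘L adjointOnto (CFC.sqrt A) = A := by
  have hs : (CFC.sqrt A)† = CFC.sqrt A := IsSelfAdjoint.of_nonneg (CFC.sqrt_nonneg A)
  rw [adjoint_comp_self_adjointOnto, hs]
  exact CFC.sqrt_mul_sqrt_self A

theorem isDefect_defect {T : E →L[ℂ] F} (hT : ‖T‖ ≤ 1) : IsDefect T (defect T) where
  denseRange := denseRange_adjointOnto _
  adjoint_comp_self := adjoint_comp_self_adjointOnto_sqrt (one_sub_adjoint_comp_self_nonneg hT)

theorem isDefect_adjoint_adjointOnto {T : E →L[ℂ] F} (hT : ‖T‖ ≤ 1) :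
    IsDefect (T†) (adjointOnto (CFC.sqrt (1 - T ∘L T†))) := by
  have hT' : ‖T†‖ ≤ 1 := by rwa [LinearIsometryEquiv.norm_map]
  have h := isDefect_defect hT'
  rwa [defect, ContinuousLinearMap.adjoint_adjoint] at h

namespace IsDefect

variable {T : E →L[ℂ] F} {D : E →L[ℂ] M} {D' : F →L[ℂ] N}

theorem adjoint_apply_apply (hD : IsDefect T D) (x : E) : (D†) (D x) = x - (T†) (T x) :=
  congr($(hD.adjoint_comp_self) x)

theorem inner_apply_apply (hD : IsDefect T D) (x y : E) :
    ⟪D x, D y⟫_ℂ = ⟪x, y⟫_ℂ - ⟪T x, T y⟫_ℂ := by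
  rw [← ContinuousLinearMap.adjoint_inner_right, hD.adjoint_apply_apply, inner_sub_right,
    ContinuousLinearMap.adjoint_inner_right]

theorem norm_sq_apply (hD : IsDefect T D) (x : E) : ‖D x‖ ^ 2 = ‖x‖ ^ 2 - ‖T x‖ ^ 2 := by
  have h := hD.inner_apply_apply x x
  simp only [inner_self_eq_norm_sq_to_K] at h
  exact_mod_cast h

theorem adjoint_injective (hD : IsDefect T D) : Function.Injective (D†) :=
  denseRange_iff_adjoint_injective.1 hD.denseRange

theorem opNorm_le_one (hD : IsDefect T D) : ‖T‖ ≤ 1 :=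
  (opNorm_le_one_iff T).2 fun x => le_of_sq_le_sq
    (by linarith [hD.norm_sq_apply x, sq_nonneg ‖D x‖]) (norm_nonneg x)

theorem norm_apply_adjoint_le (hD : IsDefect T D) (hD' : IsDefect (T†) D') (y : F) :
    ‖D ((T†) y)‖ ≤ ‖D' y‖ := by
  have h : ‖(T†) y‖ ^ 2 ≤ ‖y‖ * ‖T ((T†) y)‖ := by
    have h := norm_inner_le_norm (𝕜 := ℂ) y (T ((T†) y))
    rwa [← ContinuousLinearMap.adjoint_inner_left, inner_self_eq_norm_sq_to_K, norm_pow,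
      RCLike.norm_ofReal, abs_norm] at h
  refine le_of_sq_le_sq ?_ (norm_nonneg _)
  rw [hD.norm_sq_apply, hD'.norm_sq_apply]
  nlinarith [sq_nonneg (‖y‖ - ‖T ((T†) y)‖)]

/-- Together with `T`, `D` and `D'` the operator `Y` forms the Julia operator
`(T, D'†; D, -Y)`, which is unitary. -/
theorem exists_julia (hD : IsDefect T D) (hD' : IsDefect (T†) D') :
    ∃ Y : N →L[ℂ] M, T† ∘L D'† = D† ∘L Y ∧ D'† ∘L Y† = T ∘L D† ∧
      D' ∘L D'† + Y† ∘L Y = 1 := by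
  let Y : N →L[ℂ] M := (D ∘L T† : F →ₗ[ℂ] M).extendOfNorm D'
  have hY (y : F) : Y (D' y) = D ((T†) y) :=
    LinearMap.extendOfNorm_eq hD'.denseRange
      ⟨1, fun y => (hD.norm_apply_adjoint_le hD' y).trans_eq (one_mul _).symm⟩ y
  have hD'D' (y : F) : (D'†) (D' y) = y - T ((T†) y) := by
    simpa only [ContinuousLinearMap.adjoint_adjoint] using hD'.adjoint_apply_apply y
  have hTY : T† ∘L D'† = D† ∘L Y := by
    refine ContinuousLinearMap.coeFn_injective
      (hD'.denseRange.equalizer (by fun_prop) (by fun_prop) (funext fun y => ?_))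
    simp [hY, hD'D', hD.adjoint_apply_apply]
  have hYD : Y† ∘L D = D' ∘L T := by
    simpa [ContinuousLinearMap.adjoint_comp] using congr($hTY†).symm
  refine ⟨Y, hTY, ?_, ?_⟩
  · have : Y ∘L D' = D ∘L T† := ContinuousLinearMap.ext hY
    simpa [ContinuousLinearMap.adjoint_comp] using congr($this†)
  · refine ContinuousLinearMap.coeFn_injective
      (hD'.denseRange.equalizer (by fun_prop) (by fun_prop) (funext fun y => ?_))
    have := congr($hYD ((T†) y))
    simp only [ContinuousLinearMap.comp_apply] at this
    simp [hY, hD'D', this]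

end IsDefect

end DefectOperators

section ComplementarySpaces

variable {E F M : Type*} [NormedAddCommGroup E] [InnerProductSpace ℂ E] [NormedAddCommGroup F]
  [InnerProductSpace ℂ F]

theorem OperatorRange.incl_injective (A : E →L[ℂ] F) : Function.Injective (incl A) :=
  Submodule.injective_subtype _

variable [CompleteSpace E] [CompleteSpace F] [NormedAddCommGroup M] [InnerProductSpace ℂ M]
  [CompleteSpace M]

namespace IsDefect

variable {T : E →L[ℂ] F} {D : E →L[ℂ] M}

/-- The complementary space of `T` is isometric to the space `{(f, z) | T† f = D† z}`: the
isometry takes `f` to `(f, Z f)`. -/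
theorem exists_complementarySpace_graph (hD : IsDefect T D) :
    ∃ Z : ComplementarySpace T → M,
      (∀ f, (T†) (OperatorRange.incl _ f) = (D†) (Z f)) ∧
      (∀ f z, (T†) f = (D†) z → ∃ f' : ComplementarySpace T, OperatorRange.incl _ f' = f) ∧
      ∀ f g : ComplementarySpace T,
        ⟪f, g⟫_ℂ = ⟪OperatorRange.incl _ f, OperatorRange.incl _ g⟫_ℂ + ⟪Z f, Z g⟫_ℂ := by
  set A : F →L[ℂ] F := CFC.sqrt (1 - T ∘L T†)
  have hA : IsDefect (T†) (adjointOnto A) := isDefect_adjoint_adjointOnto hD.opNorm_le_one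
  obtain ⟨Y, hTY, hDY, hY⟩ := hD.exists_julia hA
  have incl_eq (f : ComplementarySpace T) :
      OperatorRange.incl A f = ((adjointOnto A)†) ((OperatorRange.kerPerpEquiv A).symm f) := by
    rw [adjoint_adjointOnto_apply, ← OperatorRange.incl_kerPerpEquiv, LinearEquiv.apply_symm_apply]
  refine ⟨fun f => Y ((OperatorRange.kerPerpEquiv A).symm f), fun f => ?_, fun f z h => ?_,
    fun f g => ?_⟩
  · rw [incl_eq]
    exact congr($hTY _)
  · refine ⟨OperatorRange.kerPerpEquiv A (adjointOnto A f + (Y†) z), ?_⟩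
    have hf := congr($hA.adjoint_comp_self f)
    have hz := congr($hDY z)
    simp only [ContinuousLinearMap.comp_apply] at hf hz
    rw [incl_eq, LinearEquiv.symm_apply_apply, map_add, hf, hz, ← h]
    simp
  · set x := (OperatorRange.kerPerpEquiv A).symm f
    set y := (OperatorRange.kerPerpEquiv A).symm g
    have hy : adjointOnto A (((adjointOnto A)†) y) + (Y†) (Y y) = y := congr($hY y)
    have hxy : ⟪f, g⟫_ℂ = ⟪x, y⟫_ℂ := rfl
    rw [hxy, incl_eq, incl_eq, ContinuousLinearMap.adjoint_inner_left,
      ← ContinuousLinearMap.adjoint_inner_right Y, ← inner_add_right, hy]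

variable (hD : IsDefect T D)
include hD

theorem exists_incl_eq {f : F} {z : M} (h : (T†) f = (D†) z) :
    ∃ f' : ComplementarySpace T, OperatorRange.incl _ f' = f := by
  obtain ⟨Z, -, hZ, -⟩ := hD.exists_complementarySpace_graph
  exact hZ f z h

theorem exists_adjoint_incl_eq (f : ComplementarySpace T) :
    ∃ z, (T†) (OperatorRange.incl _ f) = (D†) z := by
  obtain ⟨Z, hZ, -, -⟩ := hD.exists_complementarySpace_graph
  exact ⟨Z f, hZ f⟩

theorem inner_eq_of_adjoint_incl_eq {f g : ComplementarySpace T} {x y : M}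
    (hx : (T†) (OperatorRange.incl _ f) = (D†) x) (hy : (T†) (OperatorRange.incl _ g) = (D†) y) :
    ⟪f, g⟫_ℂ = ⟪OperatorRange.incl _ f, OperatorRange.incl _ g⟫_ℂ + ⟪x, y⟫_ℂ := by
  obtain ⟨Z, hZ, -, inner_eq⟩ := hD.exists_complementarySpace_graph
  rw [inner_eq, hD.adjoint_injective ((hZ f).symm.trans hx),
    hD.adjoint_injective ((hZ g).symm.trans hy)]

theorem norm_sq_eq_of_adjoint_incl_eq {f : ComplementarySpace T} {x : M}
    (hx : (T†) (OperatorRange.incl _ f) = (D†) x) :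
    ‖f‖ ^ 2 = ‖OperatorRange.incl _ f‖ ^ 2 + ‖x‖ ^ 2 := by
  have h := hD.inner_eq_of_adjoint_incl_eq hx hx
  simp only [inner_self_eq_norm_sq_to_K] at h
  exact_mod_cast h

theorem exists_restrict (C : F →L[ℂ] F) (C' : M →L[ℂ] M)
    (h : ∀ f z, (T†) f = (D†) z → (T†) (C f) = (D†) (C' z)) :
    ∃ X : ComplementarySpace T →L[ℂ] ComplementarySpace T,
      ∀ f, OperatorRange.incl _ (X f) = C (OperatorRange.incl _ f) := by
  have hX (f : ComplementarySpace T) :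
      ∃ f' : ComplementarySpace T, OperatorRange.incl _ f' = C (OperatorRange.incl _ f) := by
    obtain ⟨z, hz⟩ := hD.exists_adjoint_incl_eq f
    exact hD.exists_incl_eq (h _ z hz)
  choose X hX using hX
  let X' : ComplementarySpace T →ₗ[ℂ] ComplementarySpace T :=
    { toFun := X
      map_add' := fun f g => OperatorRange.incl_injective _ (by simp only [hX, map_add])
      map_smul' := fun c f => OperatorRange.incl_injective _ (by
        simp only [hX, map_smul, RingHom.id_apply]) }
  refine ⟨X'.mkContinuous (max ‖C‖ ‖C'‖) fun f => ?_, hX⟩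
  obtain ⟨z, hz⟩ := hD.exists_adjoint_incl_eq f
  have hXf := hD.norm_sq_eq_of_adjoint_incl_eq (f := X f) (by rw [hX]; exact h _ z hz)
  have hf := hD.norm_sq_eq_of_adjoint_incl_eq hz
  have hC := C.le_of_opNorm_le (le_max_left ‖C‖ ‖C'‖) (OperatorRange.incl _ f)
  have hC' := C'.le_of_opNorm_le (le_max_right ‖C‖ ‖C'‖) z
  refine le_of_sq_le_sq ?_ (by positivity)
  calc ‖X f‖ ^ 2 = ‖C (OperatorRange.incl _ f)‖ ^ 2 + ‖C' z‖ ^ 2 := by rw [hXf, hX]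
    _ ≤ (max ‖C‖ ‖C'‖ * ‖OperatorRange.incl _ f‖) ^ 2 + (max ‖C‖ ‖C'‖ * ‖z‖) ^ 2 := by gcongr
    _ = (max ‖C‖ ‖C'‖ * ‖f‖) ^ 2 := by rw [mul_pow, mul_pow, mul_pow, hf]; ring

end IsDefect

end ComplementarySpaces

section RowIsometries

variable {ι M : Type*} [NormedAddCommGroup M] [InnerProductSpace ℂ M]

/-- The operators `V k` are isometries with mutually orthogonal ranges; equivalently, the row
`(V k)_k` is an isometry. -/
structure IsRowIsometry (V : ι → M →L[ℂ] M) : Prop where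
  norm_apply : ∀ k x, ‖V k x‖ = ‖x‖
  inner_eq_zero : ∀ ⦃j k⦄, j ≠ k → ∀ x y, ⟪V j x, V k y⟫_ℂ = 0

namespace IsRowIsometry

variable {V : ι → M →L[ℂ] M}

theorem inner_apply_apply (hV : IsRowIsometry V) (k : ι) (x y : M) :
    ⟪V k x, V k y⟫_ℂ = ⟪x, y⟫_ℂ :=
  (LinearMap.norm_map_iff_inner_map_map (V k)).1 (hV.norm_apply k) x y

theorem orthogonalFamily (hV : IsRowIsometry V) :
    OrthogonalFamily ℂ (fun _ => M)
      fun k => (⟨(V k : M →ₗ[ℂ] M), hV.norm_apply k⟩ : M →ₗᵢ[ℂ] M) :=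
  fun _ _ h => hV.inner_eq_zero h

variable [CompleteSpace M]

theorem adjoint_apply_self (hV : IsRowIsometry V) (k : ι) (x : M) : ((V k)†) (V k x) = x :=
  ext_inner_right ℂ fun y => by
    rw [ContinuousLinearMap.adjoint_inner_left, hV.inner_apply_apply]

theorem adjoint_apply_of_ne (hV : IsRowIsometry V) {j k : ι} (h : j ≠ k) (x : M) :
    ((V j)†) (V k x) = 0 :=
  ext_inner_right ℂ fun y => by
    rw [ContinuousLinearMap.adjoint_inner_left, hV.inner_eq_zero h.symm, inner_zero_left]

theorem hasSum_norm_sq_adjoint (hV : IsRowIsometry V) {c y : M} (hc : ∀ k, ((V k)†) c = 0)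
    (hy : y - c ∈ (⨆ k, (V k).range).topologicalClosure) :
    HasSum (fun k => ‖((V k)†) y‖ ^ 2) (‖y‖ ^ 2 - ‖c‖ ^ 2) := by
  classical
  obtain ⟨g, hg⟩ : ∃ g : lp (fun _ : ι => M) 2, hV.orthogonalFamily.linearIsometry g = y - c := by
    exact hV.orthogonalFamily.range_linearIsometry.ge hy
  have adjoint_eq (k : ι) : ((V k)†) (y - c) = g k := by
    refine ext_inner_left ℂ fun x => ?_
    have hx : V k x = hV.orthogonalFamily.linearIsometry (lp.single 2 k x) :=
      (hV.orthogonalFamily.linearIsometry_apply_single x).symm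
    rw [ContinuousLinearMap.adjoint_inner_right, ← hg, hx, LinearIsometry.inner_map_map,
      lp.inner_single_left]
  have inner_eq_zero : ⟪c, y - c⟫_ℂ = 0 := by
    have hc' : c ∈ (⨆ k, (V k).range)ᗮ := by
      simp only [← Submodule.iInf_orthogonal, Submodule.mem_iInf,
        ContinuousLinearMap.orthogonal_range]
      exact hc
    rw [← Submodule.orthogonal_closure] at hc'
    exact Submodule.inner_left_of_mem_orthogonal hy hc'
  have norm_eq : ‖y‖ ^ 2 - ‖c‖ ^ 2 = ‖g‖ ^ 2 := by
    have h := norm_add_sq_eq_norm_sq_add_norm_sq_of_inner_eq_zero c (y - c) inner_eq_zero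
    rw [add_sub_cancel, ← hg, LinearIsometry.norm_map] at h
    linarith
  have hsum := lp.hasSum_norm (p := 2) (by norm_num) g
  simpa [norm_eq, ← adjoint_eq, map_sub, hc] using hsum

end IsRowIsometry

end RowIsometries

section FockSpace

variable {ι : Type*}

open Classical in
/-- The monomial `z^w`, as a vector of Fock space. -/
def monomial (w : List ι) : Fock ι := lp.single 2 w 1

theorem monomial_nil : monomial [] = vacuum ι := rfl

theorem inner_monomial_left (w : List ι) (h : Fock ι) : ⟪monomial w, h⟫_ℂ = h w := by
  classical
  rw [monomial, lp.inner_single_left, RCLike.inner_apply, map_one, mul_one]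

theorem inner_vacuum_left (h : Fock ι) : ⟪vacuum ι, h⟫_ℂ = h [] :=
  inner_monomial_left [] h

open Classical in
theorem monomial_apply (w v : List ι) : monomial w v = if v = w then 1 else 0 := by
  rw [monomial, lp.single_apply, Pi.single_apply]

theorem vacuum_apply_nil : vacuum ι [] = 1 := by
  classical
  exact (monomial_apply [] []).trans (if_pos rfl)

theorem sub_smul_vacuum_apply_nil (h : Fock ι) : (h - h [] • vacuum ι) [] = 0 := by
  rw [lp.coeFn_sub, Pi.sub_apply, lp.coeFn_smul, Pi.smul_apply, vacuum_apply_nil, smul_eq_mul,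
    mul_one, sub_self]

theorem norm_vacuum : ‖vacuum ι‖ = 1 := by
  classical
  rw [vacuum, lp.norm_single (by norm_num), norm_one]

theorem norm_coeff_le (h : Fock ι) (w : List ι) : ‖h w‖ ≤ ‖h‖ :=
  lp.norm_apply_le_norm (by norm_num) h w

theorem hasSum_monomial (h : Fock ι) : HasSum (fun w => h w • monomial w) h := by
  classical
  refine (lp.hasSum_single (p := 2) (by norm_num) h).congr_fun fun w => ?_
  rw [monomial, ← lp.single_smul, smul_eq_mul, mul_one]

theorem ext_monomial {E : Type*} [NormedAddCommGroup E] [NormedSpace ℂ E] {A B : Fock ι →L[ℂ] E}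
    (h : ∀ w, A (monomial w) = B (monomial w)) : A = B := by
  ext x
  have hA := (hasSum_monomial x).mapL A
  have hB := (hasSum_monomial x).mapL B
  simp only [map_smul, h] at hA hB
  exact hA.unique hB

theorem mem_topologicalClosure_of_apply_nil_eq_zero {p : Submodule ℂ (Fock ι)}
    (hp : ∀ k w, monomial (k :: w) ∈ p) {h : Fock ι} (h0 : h [] = 0) :
    h ∈ p.topologicalClosure := by
  refine p.isClosed_topologicalClosure.mem_of_tendsto (hasSum_monomial h)
    (.of_forall fun s => p.le_topologicalClosure (p.sum_mem fun w _ => ?_))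
  cases w with
  | nil => simp only [h0, zero_smul, p.zero_mem]
  | cons k w => exact p.smul_mem _ (hp k w)

theorem leftShift_nil (k : ι) (h : Fock ι) : leftShift k h [] = 0 := by
  classical
  simp [leftShift_apply, ncMul]

theorem leftShift_monomial (k : ι) (w : List ι) : leftShift k (monomial w) = monomial (k :: w) := by
  refine ext_inner_right ℂ fun h => ?_
  rw [← ContinuousLinearMap.adjoint_inner_right, inner_monomial_left, inner_monomial_left,
    adjoint_leftShift_apply]

theorem adjoint_leftShift_vacuum (k : ι) : ((leftShift k)†) (vacuum ι) = 0 :=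
  ext_inner_right ℂ fun h => by
    rw [ContinuousLinearMap.adjoint_inner_left, inner_vacuum_left, leftShift_nil, inner_zero_left]

open Classical in
theorem adjoint_leftShift_leftShift (j k : ι) (h : Fock ι) :
    ((leftShift j)†) (leftShift k h) = if j = k then h else 0 := by
  have key : (leftShift j)† ∘L leftShift k = if j = k then ContinuousLinearMap.id ℂ _ else 0 := by
    refine ext_monomial fun w => ?_
    ext v
    rw [ContinuousLinearMap.comp_apply, leftShift_monomial, adjoint_leftShift_apply,
      monomial_apply]
    split_ifs <;> simp_all [monomial_apply]
  rw [← ContinuousLinearMap.comp_apply, key]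
  split_ifs <;> rfl

theorem isRowIsometry_leftShift : IsRowIsometry (leftShift (ι := ι)) where
  norm_apply k := (leftShift k).norm_map_iff_adjoint_comp_self.2 <|
    ContinuousLinearMap.ext fun x => (adjoint_leftShift_leftShift k k x).trans (if_pos rfl)
  inner_eq_zero j k h x y := by
    rw [← ContinuousLinearMap.adjoint_inner_right, adjoint_leftShift_leftShift, if_neg h,
      inner_zero_right]

theorem hasSum_norm_sq_adjoint_leftShift (h : Fock ι) :
    HasSum (fun k => ‖((leftShift k)†) h‖ ^ 2) (‖h‖ ^ 2 - ‖h []‖ ^ 2) := by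
  have hmem (k : ι) (w : List ι) : monomial (k :: w) ∈ ⨆ k, (leftShift (ι := ι) k).range :=
    Submodule.mem_iSup_of_mem k ⟨monomial w, leftShift_monomial k w⟩
  have hsum := isRowIsometry_leftShift.hasSum_norm_sq_adjoint
    (fun k => by rw [map_smul, adjoint_leftShift_vacuum, smul_zero])
    (mem_topologicalClosure_of_apply_nil_eq_zero hmem (sub_smul_vacuum_apply_nil h))
  rwa [norm_smul, norm_vacuum, mul_one] at hsum

end FockSpace

section WanderingVectors

variable {ι M : Type*} [NormedAddCommGroup M] [InnerProductSpace ℂ M] [CompleteSpace M]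

/-- `e` is a unit vector which is orthogonal to the ranges of the operators `V k`. -/
structure IsUnitWandering (V : ι → M →L[ℂ] M) (e : M) : Prop where
  norm_eq_one : ‖e‖ = 1
  adjoint_apply : ∀ k, ((V k)†) e = 0

namespace IsUnitWandering

variable {V : ι → M →L[ℂ] M} {e : M}

theorem orthonormal (he : IsUnitWandering V e) (hV : IsRowIsometry V) :
    Orthonormal ℂ fun w : List ι => (w.map V).prod e := by
  have inner_left (k : ι) (x : M) : ⟪e, V k x⟫_ℂ = 0 := by
    rw [← ContinuousLinearMap.adjoint_inner_left, he.adjoint_apply, inner_zero_left]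
  refine ⟨fun w => ?_, fun w => ?_⟩
  · induction w with
    | nil => exact he.norm_eq_one
    | cons k w ih => exact (hV.norm_apply k _).trans ih
  · induction w with
    | nil =>
      rintro (_ | ⟨k, v⟩) h
      · exact absurd rfl h
      · exact inner_left k _
    | cons j w ih =>
      rintro (_ | ⟨k, v⟩) h
      · exact inner_eq_zero_symm.1 (inner_left j _)
      · obtain rfl | hjk := eq_or_ne j k
        · exact (hV.inner_apply_apply j _ _).trans (ih fun h' => h (congrArg _ h'))
        · exact hV.inner_eq_zero hjk _ _

/-- The isometry of Fock space into `M` which maps `z^w` to `V^w e` and intertwines the left shifts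
with the operators `V k`. -/
def embedding (he : IsUnitWandering V e) (hV : IsRowIsometry V) : Fock ι →ₗᵢ[ℂ] M :=
  (he.orthonormal hV).orthogonalFamily.linearIsometry

variable (he : IsUnitWandering V e) (hV : IsRowIsometry V)

theorem embedding_monomial (w : List ι) : he.embedding hV (monomial w) = (w.map V).prod e := by
  classical
  rw [embedding, monomial, OrthogonalFamily.linearIsometry_apply_single,
    LinearIsometry.toSpanSingleton_apply, one_smul]

theorem embedding_vacuum : he.embedding hV (vacuum ι) = e :=
  he.embedding_monomial hV []

/-- The adjoint of `embedding`. -/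
def coembedding : M →L[ℂ] Fock ι := (he.embedding hV).toContinuousLinearMap†

theorem coembedding_apply (y : M) (w : List ι) :
    he.coembedding hV y w = ⟪(w.map V).prod e, y⟫_ℂ := by
  rw [← inner_monomial_left, coembedding, ContinuousLinearMap.adjoint_inner_right,
    ← embedding_monomial he hV]
  rfl

theorem coembedding_embedding (h : Fock ι) : he.coembedding hV (he.embedding hV h) = h :=
  ext_inner_left ℂ fun g => by
    rw [coembedding, ContinuousLinearMap.adjoint_inner_right]
    exact (he.embedding hV).inner_map_map g h

theorem embedding_coembedding_self : he.embedding hV (he.coembedding hV e) = e := by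
  have h := congrArg (he.embedding hV) (he.coembedding_embedding hV (vacuum ι))
  rwa [he.embedding_vacuum] at h

theorem norm_coembedding_le (y : M) : ‖he.coembedding hV y‖ ≤ ‖y‖ := by
  refine (opNorm_le_one_iff _).1 ?_ y
  rw [coembedding, LinearIsometryEquiv.norm_map]
  exact (he.embedding hV).norm_toContinuousLinearMap_le

theorem embedding_leftShift (k : ι) (h : Fock ι) :
    he.embedding hV (leftShift k h) = V k (he.embedding hV h) := by
  have key : (he.embedding hV).toContinuousLinearMap ∘L leftShift k =
      V k ∘L (he.embedding hV).toContinuousLinearMap := by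
    refine ext_monomial fun w => ?_
    simp [leftShift_monomial, embedding_monomial]
  exact congr($key h)

theorem coembedding_apply_apply (k : ι) (y : M) :
    he.coembedding hV (V k y) = leftShift k (he.coembedding hV y) := by
  have key : (V k)† ∘L (he.embedding hV).toContinuousLinearMap =
      (he.embedding hV).toContinuousLinearMap ∘L (leftShift k)† := by
    refine ext_monomial fun w => ?_
    cases w with
    | nil =>
      simp [monomial_nil, embedding_vacuum, he.adjoint_apply, adjoint_leftShift_vacuum]
    | cons j w =>
      simp only [ContinuousLinearMap.comp_apply, LinearIsometry.coe_toContinuousLinearMap]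
      rw [embedding_monomial, ← leftShift_monomial, List.map_cons, List.prod_cons,
        mul_apply_eq_comp]
      obtain rfl | hjk := eq_or_ne k j
      · rw [hV.adjoint_apply_self, isRowIsometry_leftShift.adjoint_apply_self, embedding_monomial]
      · rw [hV.adjoint_apply_of_ne hjk, isRowIsometry_leftShift.adjoint_apply_of_ne hjk, map_zero]
  have key' := congr($key†)
  rw [ContinuousLinearMap.adjoint_comp, ContinuousLinearMap.adjoint_comp,
    ContinuousLinearMap.adjoint_adjoint, ContinuousLinearMap.adjoint_adjoint] at key'
  exact congr($key' y)

end IsUnitWandering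

end WanderingVectors

section CommutingWithShifts

variable {ι : Type*}

/-- `S` commutes with the left shifts; equivalently, `S` is right multiplication by a power
series. -/
def CommutesWithShifts (S : Fock ι →L[ℂ] Fock ι) : Prop :=
  ∀ k, Function.Semiconj S (leftShift k) (leftShift k)

theorem ncMul_cons (f g : List ι → ℂ) (k : ι) (w : List ι) :
    ncMul f g (k :: w) = f [] * g (k :: w) + ncMul (fun v => f (k :: v)) g w := by
  rw [ncMul, List.length_cons, Finset.sum_range_succ', add_comm]
  rfl

namespace CommutesWithShifts

variable {S : Fock ι →L[ℂ] Fock ι} (hS : CommutesWithShifts S)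
include hS

theorem apply_nil (h : Fock ι) : S h [] = h [] * S (vacuum ι) [] := by
  have key : innerSL ℂ (vacuum ι) ∘L S = S (vacuum ι) [] • innerSL ℂ (vacuum ι) := by
    refine ext_monomial fun w => ?_
    cases w with
    | nil => simp [monomial_nil, inner_vacuum_left, norm_vacuum]
    | cons k w =>
      simp [inner_vacuum_left, ← leftShift_monomial, (hS k).eq, leftShift_nil]
  have h' := congr($key h)
  simpa [inner_vacuum_left, mul_comm] using h'

theorem adjoint_leftShift_apply (k : ι) (h : Fock ι) :
    ((leftShift k)†) (S h) =
      h [] • ((leftShift k)†) (S (vacuum ι)) + S (((leftShift k)†) h) := by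
  classical
  have key : (leftShift k)† ∘L S =
      (innerSL ℂ (vacuum ι)).smulRight (((leftShift k)†) (S (vacuum ι))) +
        S ∘L (leftShift k)† := by
    refine ext_monomial fun w => ?_
    cases w with
    | nil => simp [monomial_nil, norm_vacuum, adjoint_leftShift_vacuum]
    | cons j w =>
      simp [inner_vacuum_left, ← leftShift_monomial, (hS j).eq, leftShift_nil,
        adjoint_leftShift_leftShift, apply_ite S]
  simpa [inner_vacuum_left] using congr($key h)

theorem apply_eq_ncMul (h : Fock ι) (w : List ι) : S h w = ncMul h (S (vacuum ι)) w := by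
  induction w generalizing h with
  | nil => simpa [ncMul] using hS.apply_nil h
  | cons k w ih =>
    have hk := congr($(hS.adjoint_leftShift_apply k h) w)
    have coeff_eq : (((leftShift k)†) h : List ι → ℂ) = fun v => h (k :: v) :=
      funext (FreeSarason.adjoint_leftShift_apply k h)
    rw [FreeSarason.adjoint_leftShift_apply, lp.coeFn_add, Pi.add_apply, ih, coeff_eq,
      lp.coeFn_smul, Pi.smul_apply, FreeSarason.adjoint_leftShift_apply, smul_eq_mul] at hk
    rw [hk, ncMul_cons]

end CommutesWithShifts

end CommutingWithShifts

section Residual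

variable {ι G H : Type*} [NormedAddCommGroup G] [InnerProductSpace ℂ G] [CompleteSpace G]
  [NormedAddCommGroup H] [InnerProductSpace ℂ H] [CompleteSpace H]

/-- The part of `D 1` which is orthogonal to `D h` for all power series `h` without constant term.
The square of its norm is the infimum of `‖D x‖ ^ 2` over the power series `x` with constant
term `1`. -/
def residual (D : Fock ι →L[ℂ] G) : G :=
  ((ℂ ∙ vacuum ι)ᗮ.map (D : Fock ι →ₗ[ℂ] G))ᗮ.starProjection (D (vacuum ι))

theorem mem_orthogonal_span_vacuum_iff {h : Fock ι} : h ∈ (ℂ ∙ vacuum ι)ᗮ ↔ h [] = 0 := by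
  rw [Submodule.mem_orthogonal_singleton_iff_inner_right, inner_vacuum_left]

variable (D : Fock ι →L[ℂ] G)

theorem apply_vacuum_sub_residual_mem :
    D (vacuum ι) - residual D ∈
      ((ℂ ∙ vacuum ι)ᗮ.map (D : Fock ι →ₗ[ℂ] G)).topologicalClosure := by
  rw [← Submodule.orthogonal_orthogonal_eq_closure]
  exact Submodule.sub_starProjection_mem_orthogonal _

theorem adjoint_apply_residual :
    (D†) (residual D) = ((‖residual D‖ ^ 2 : ℝ) : ℂ) • vacuum ι := by
  set K := (ℂ ∙ vacuum ι)ᗮ.map (D : Fock ι →ₗ[ℂ] G)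
  have hK : residual D ∈ Kᗮ := Submodule.starProjection_apply_mem _ _
  have inner_vacuum : ⟪D (vacuum ι), residual D⟫_ℂ = (‖residual D‖ ^ 2 : ℝ) := by
    have h : ⟪D (vacuum ι) - residual D, residual D⟫_ℂ = 0 :=
      Submodule.starProjection_inner_eq_zero _ _ hK
    rw [inner_sub_left, sub_eq_zero, inner_self_eq_norm_sq_to_K] at h
    exact_mod_cast h
  refine ext_inner_left ℂ fun h => ?_
  have h0 : h - h [] • vacuum ι ∈ (ℂ ∙ vacuum ι)ᗮ :=
    mem_orthogonal_span_vacuum_iff.2 (sub_smul_vacuum_apply_nil h)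
  have inner_sub : ⟪D (h - h [] • vacuum ι), residual D⟫_ℂ = 0 :=
    hK _ (Submodule.mem_map_of_mem h0)
  rw [map_sub, map_smul, inner_sub_left, inner_smul_left, inner_vacuum, sub_eq_zero] at inner_sub
  rw [ContinuousLinearMap.adjoint_inner_right, inner_sub, inner_smul_right, ← inner_conj_symm,
    inner_vacuum_left, mul_comm]

theorem inner_residual_apply (h : Fock ι) :
    ⟪residual D, D h⟫_ℂ = (‖residual D‖ ^ 2 : ℝ) * h [] := by
  rw [← ContinuousLinearMap.adjoint_inner_left, adjoint_apply_residual, inner_smul_left,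
    inner_vacuum_left, Complex.conj_ofReal]

theorem norm_residual_le {x : Fock ι} (hx : x [] = 1) : ‖residual D‖ ≤ ‖D x‖ := by
  have h := norm_inner_le_norm (𝕜 := ℂ) (residual D) (D x)
  rw [inner_residual_apply, hx, mul_one, Complex.norm_of_nonneg (sq_nonneg _), sq] at h
  obtain h0 | h0 := (norm_nonneg (residual D)).eq_or_lt'
  · exact h0.trans_le (norm_nonneg _)
  · exact le_of_mul_le_mul_left h h0

variable {D} in
theorem residual_eq_zero_of_comp_eq {D' : Fock ι →L[ℂ] H} {N : G →L[ℂ] H} (hN : N ∘L D = D')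
    (h0 : N (residual D) = 0) : residual D' = 0 := by
  rw [residual, Submodule.starProjection_apply_eq_zero_iff,
    Submodule.orthogonal_orthogonal_eq_closure]
  have h : N (D (vacuum ι) - residual D) = D' (vacuum ι) := by
    rw [map_sub, h0, sub_zero, ← hN, ContinuousLinearMap.comp_apply]
  rw [← h]
  refine map_mem_closure N.continuous (apply_vacuum_sub_residual_mem D) ?_
  rintro _ ⟨p, hp, rfl⟩
  exact ⟨p, hp, congr($hN.symm p)⟩

/-- The free polynomials without constant term. -/
def augmentation (ι : Type*) : Submodule ℂ (Fock ι) where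
  carrier := {p | IsFreePolynomial p ∧ p [] = 0}
  add_mem' {p q} hp hq := by
    refine ⟨(hp.1.union hq.1).subset fun w hw => ?_, by simp [hp.2, hq.2]⟩
    by_contra! h
    simp_all
  zero_mem' := ⟨by simp [IsFreePolynomial], rfl⟩
  smul_mem' c p hp := ⟨hp.1.subset fun w hw => by simp_all, by simp [hp.2]⟩

theorem monomial_cons_mem_augmentation (k : ι) (w : List ι) :
    monomial (k :: w) ∈ augmentation ι := by
  classical
  refine ⟨(Set.finite_singleton (k :: w)).subset fun v hv => ?_, ?_⟩
  · by_contra h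
    exact hv ((monomial_apply _ _).trans (if_neg h))
  · exact (monomial_apply _ _).trans (if_neg (List.cons_ne_nil k w).symm)

variable {D} in
theorem le_norm_residual_sq {r : ℝ} (hr : ∀ p ∈ augmentation ι, r ≤ ‖D (vacuum ι - p)‖ ^ 2) :
    r ≤ ‖residual D‖ ^ 2 := by
  have hr' {h : Fock ι} (h0 : h [] = 0) : r ≤ ‖D (vacuum ι - h)‖ ^ 2 := by
    have hclosed : IsClosed {h | r ≤ ‖D (vacuum ι - h)‖ ^ 2} :=
      isClosed_le continuous_const (by fun_prop)
    exact closure_minimal hr hclosed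
      (mem_topologicalClosure_of_apply_nil_eq_zero monomial_cons_mem_augmentation h0)
  have hclosed : IsClosed {y | r ≤ ‖D (vacuum ι) - y‖ ^ 2} :=
    isClosed_le continuous_const (by fun_prop)
  have hmem := closure_minimal (s := (ℂ ∙ vacuum ι)ᗮ.map (D : Fock ι →ₗ[ℂ] G)) ?_ hclosed
    (apply_vacuum_sub_residual_mem D)
  · simpa using hmem
  · rintro _ ⟨h, h0, rfl⟩
    have h' := hr' (mem_orthogonal_span_vacuum_iff.1 h0)
    rwa [map_sub] at h'

theorem isGLB_norm_residual_sq :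
    IsGLB {r : ℝ | ∃ p : Fock ι, IsFreePolynomial p ∧ p [] = 0 ∧ r = ‖D (vacuum ι - p)‖ ^ 2}
      (‖residual D‖ ^ 2) := by
  refine ⟨?_, fun r hr => le_norm_residual_sq fun p hp => hr ⟨p, hp.1, hp.2, rfl⟩⟩
  rintro _ ⟨p, -, hp, rfl⟩
  gcongr
  exact norm_residual_le D (by simp [hp, vacuum_apply_nil])

end Residual

theorem CommutesWithShifts.eq_zero_of_residual_eq_zero {ι : Type*} {S : Fock ι →L[ℂ] Fock ι}
    (hS : CommutesWithShifts S) (h0 : residual S = 0) : S = 0 := by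
  -- The terms of lowest degree of `S 1` are also terms of `S x` if `x` has constant term `1`.
  have coeff_eq_zero (n : ℕ) (w : List ι) (hw : w.length = n) : S (vacuum ι) w = 0 := by
    induction n using Nat.strong_induction_on generalizing w with
    | _ n ih =>
      have apply_eq {x : Fock ι} (hx : x [] = 1) : S x w = S (vacuum ι) w := by
        rw [hS.apply_eq_ncMul, ncMul, Finset.sum_eq_single 0]
        · simp [hx]
        · intro m hm hm0
          rw [Finset.mem_range] at hm
          rw [ih _ _ _ rfl, mul_zero]
          rw [List.length_drop]
          lia
        · simp
      have h := le_norm_residual_sq (D := S) (r := ‖S (vacuum ι) w‖ ^ 2) fun p hp => by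
        rw [← apply_eq (x := vacuum ι - p) (by simp [hp.2, vacuum_apply_nil])]
        gcongr
        exact norm_coeff_le _ _
      simpa [h0] using h
  ext x w
  rw [hS.apply_eq_ncMul, ncMul]
  exact Finset.sum_eq_zero fun n _ => by rw [coeff_eq_zero _ _ rfl, mul_zero]

section Toeplitz

variable {ι G H : Type*} [NormedAddCommGroup G] [InnerProductSpace ℂ G] [CompleteSpace G]
  [NormedAddCommGroup H] [InnerProductSpace ℂ H] [CompleteSpace H]

/-- `D† D` is a multi-Toeplitz operator, i.e. `L_j† D† D L_k = δ_jk D† D`. -/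
structure IsToeplitzFactor (D : Fock ι →L[ℂ] G) : Prop where
  norm_apply : ∀ k x, ‖D (leftShift k x)‖ = ‖D x‖
  inner_eq_zero : ∀ ⦃j k⦄, j ≠ k → ∀ x y, ⟪D (leftShift j x), D (leftShift k y)⟫_ℂ = 0

theorem CommutesWithShifts.isToeplitzFactor {S : Fock ι →L[ℂ] Fock ι} (hS : CommutesWithShifts S) :
    IsToeplitzFactor S where
  norm_apply k x := by rw [(hS k).eq, isRowIsometry_leftShift.norm_apply]
  inner_eq_zero j k h x y := by
    rw [(hS j).eq, (hS k).eq, isRowIsometry_leftShift.inner_eq_zero h]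

theorem IsDefect.isToeplitzFactor {T : Fock ι →L[ℂ] H} {D : Fock ι →L[ℂ] G} (hD : IsDefect T D)
    (hT : IsToeplitzFactor T) : IsToeplitzFactor D where
  norm_apply k x := (sq_eq_sq₀ (norm_nonneg _) (norm_nonneg _)).1 <| by
    rw [hD.norm_sq_apply, hD.norm_sq_apply, hT.norm_apply, isRowIsometry_leftShift.norm_apply]
  inner_eq_zero j k h x y := by
    rw [hD.inner_apply_apply, hT.inner_eq_zero h, isRowIsometry_leftShift.inner_eq_zero h, sub_zero]

/-- The left shift transported along `D`: the continuous extension of `D h ↦ D (L_k h)`, which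
exists if `D` is a Toeplitz factor with dense range. -/
def toeplitzShift (D : Fock ι →L[ℂ] G) (k : ι) : G →L[ℂ] G :=
  (D ∘L leftShift k : Fock ι →ₗ[ℂ] G).extendOfNorm D

namespace IsToeplitzFactor

variable {D : Fock ι →L[ℂ] G} (hD : IsToeplitzFactor D) (hd : DenseRange D)
include hD hd

theorem toeplitzShift_apply (k : ι) (x : Fock ι) : toeplitzShift D k (D x) = D (leftShift k x) :=
  LinearMap.extendOfNorm_eq hd
    ⟨1, fun x => (hD.norm_apply k x).trans_le (one_mul ‖D x‖).ge⟩ x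

theorem isRowIsometry_toeplitzShift : IsRowIsometry (toeplitzShift D) where
  norm_apply k := by
    refine isClosed_property hd (isClosed_eq (by fun_prop) (by fun_prop)) fun x => ?_
    rw [hD.toeplitzShift_apply hd, hD.norm_apply]
  inner_eq_zero j k h := by
    refine isClosed_property2 hd (isClosed_eq (by fun_prop) (by fun_prop)) fun x y => ?_
    rw [hD.toeplitzShift_apply hd, hD.toeplitzShift_apply hd, hD.inner_eq_zero h]

theorem exists_comp_eq {S : Fock ι →L[ℂ] Fock ι} (hS : CommutesWithShifts S)
    (hSD : ∀ h, ‖S h‖ ≤ ‖D h‖) :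
    ∃ N : G →L[ℂ] Fock ι, N ∘L D = S ∧ (∀ y, ‖N y‖ ≤ ‖y‖) ∧
      ∀ k, Function.Semiconj N (toeplitzShift D k) (leftShift k) := by
  have hSD' (h : Fock ι) : ‖S h‖ ≤ 1 * ‖D h‖ := (hSD h).trans_eq (one_mul _).symm
  let N : G →L[ℂ] Fock ι := (S : Fock ι →ₗ[ℂ] Fock ι).extendOfNorm D
  have hN (h : Fock ι) : N (D h) = S h := LinearMap.extendOfNorm_eq hd ⟨1, hSD'⟩ h
  refine ⟨N, ContinuousLinearMap.ext hN, fun y => ?_, fun k => ?_⟩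
  · exact (LinearMap.norm_extendOfNorm_apply_le hd 1 hSD' y).trans_eq (one_mul _)
  · refine isClosed_property hd (isClosed_eq (by fun_prop) (by fun_prop)) fun h => ?_
    rw [hD.toeplitzShift_apply hd, hN, hN, (hS k).eq]

theorem adjoint_leftShift_adjoint_apply (k : ι) (y : G) :
    ((leftShift k)†) ((D†) y) = (D†) (((toeplitzShift D k)†) y) :=
  ext_inner_right ℂ fun x => by
    simp only [ContinuousLinearMap.adjoint_inner_left, hD.toeplitzShift_apply hd]

theorem adjoint_toeplitzShift_residual (k : ι) : ((toeplitzShift D k)†) (residual D) = 0 :=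
  hd.eq_zero_of_inner_left ℂ fun x => by
    rw [ContinuousLinearMap.adjoint_inner_left, hD.toeplitzShift_apply hd, inner_residual_apply,
      leftShift_nil, mul_zero]

theorem inner_prod_map_toeplitzShift_residual {w : List ι} (hw : w ≠ []) :
    ⟪(w.map (toeplitzShift D)).prod (residual D), residual D⟫_ℂ = 0 := by
  obtain ⟨k, w, rfl⟩ := List.exists_cons_of_ne_nil hw
  rw [List.map_cons, List.prod_cons, mul_apply_eq_comp,
    ← ContinuousLinearMap.adjoint_inner_right, hD.adjoint_toeplitzShift_residual hd,
    inner_zero_right]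

theorem hasSum_norm_sq_adjoint_toeplitzShift :
    HasSum (fun k => ‖((toeplitzShift D k)†) (D (vacuum ι))‖ ^ 2)
      (‖D (vacuum ι)‖ ^ 2 - ‖residual D‖ ^ 2) := by
  refine (hD.isRowIsometry_toeplitzShift hd).hasSum_norm_sq_adjoint
    (hD.adjoint_toeplitzShift_residual hd) ?_
  set R := (⨆ k, (toeplitzShift D k).range).topologicalClosure
  have hR (k : ι) (w : List ι) : monomial (k :: w) ∈ R.comap (D : Fock ι →ₗ[ℂ] G) := by
    refine Submodule.le_topologicalClosure _ (Submodule.mem_iSup_of_mem k ⟨D (monomial w), ?_⟩)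
    exact (hD.toeplitzShift_apply hd k _).trans (by rw [leftShift_monomial]; rfl)
  have hclosed : IsClosed (R.comap (D : Fock ι →ₗ[ℂ] G) : Set (Fock ι)) :=
    (Submodule.isClosed_topologicalClosure _).preimage D.continuous
  refine Submodule.topologicalClosure_minimal _ (Submodule.map_le_iff_le_comap.2 fun h h0 => ?_)
    (Submodule.isClosed_topologicalClosure _) (apply_vacuum_sub_residual_mem D)
  rw [← hclosed.submodule_topologicalClosure_eq]
  exact mem_topologicalClosure_of_apply_nil_eq_zero hR (mem_orthogonal_span_vacuum_iff.1 h0)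

end IsToeplitzFactor

end Toeplitz

section OuterFactor

variable {ι G H : Type*} [NormedAddCommGroup G] [InnerProductSpace ℂ G] [CompleteSpace G]
  [NormedAddCommGroup H] [InnerProductSpace ℂ H] [CompleteSpace H]

namespace IsToeplitzFactor

variable {D : Fock ι →L[ℂ] G} (hD : IsToeplitzFactor D) (hd : DenseRange D) (hu : residual D ≠ 0)

include hD hd hu in
theorem isUnitWandering :
    IsUnitWandering (toeplitzShift D) (((‖residual D‖⁻¹ : ℝ) : ℂ) • residual D) where
  norm_eq_one := by
    rw [norm_smul, Complex.norm_of_nonneg (by positivity),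
      inv_mul_cancel₀ (norm_ne_zero_iff.2 hu)]
  adjoint_apply k := by rw [map_smul, hD.adjoint_toeplitzShift_residual hd, smul_zero]

/-- The outer right multiplication operator `S` for which `S† S` is the maximal factorizable
minorant of `D† D`. It compresses `D` to the subspace generated from `residual D` by the operators
`toeplitzShift D k`, and identifies this subspace with Fock space. -/
def outerFactor : Fock ι →L[ℂ] Fock ι :=
  (hD.isUnitWandering hd hu).coembedding (hD.isRowIsometry_toeplitzShift hd) ∘L D

theorem outerFactor_apply (h : Fock ι) (w : List ι) :
    hD.outerFactor hd hu h w =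
      (‖residual D‖⁻¹ : ℝ) * ⟪(w.map (toeplitzShift D)).prod (residual D), D h⟫_ℂ := by
  rw [outerFactor, ContinuousLinearMap.comp_apply, IsUnitWandering.coembedding_apply, map_smul,
    inner_smul_left, Complex.conj_ofReal]

theorem outerFactor_apply_nil (h : Fock ι) :
    hD.outerFactor hd hu h [] = ‖residual D‖ * h [] := by
  have h0 : (‖residual D‖ : ℂ) ≠ 0 := by simpa using hu
  rw [outerFactor_apply, List.map_nil, List.prod_nil, one_apply_eq_self, inner_residual_apply]
  push_cast
  field_simp

theorem commutesWithShifts_outerFactor : CommutesWithShifts (hD.outerFactor hd hu) := fun k h => by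
  simp only [outerFactor, ContinuousLinearMap.comp_apply, ← hD.toeplitzShift_apply hd,
    IsUnitWandering.coembedding_apply_apply]

theorem norm_outerFactor_apply_le (h : Fock ι) : ‖hD.outerFactor hd hu h‖ ≤ ‖D h‖ :=
  (hD.isUnitWandering hd hu).norm_coembedding_le (hD.isRowIsometry_toeplitzShift hd) (D h)

theorem denseRange_outerFactor : DenseRange (hD.outerFactor hd hu) := by
  have he := hD.isUnitWandering hd hu
  have hV := hD.isRowIsometry_toeplitzShift hd
  have hsurj : Function.Surjective (he.coembedding hV) :=
    Function.LeftInverse.surjective (he.coembedding_embedding hV)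
  exact hsurj.denseRange.comp hd (he.coembedding hV).continuous

theorem comp_eq_comp_embedding_comp_outerFactor {N : G →L[ℂ] Fock ι}
    (hN : ∀ k, Function.Semiconj N (toeplitzShift D k) (leftShift k)) :
    N ∘L D = N ∘L ((hD.isUnitWandering hd hu).embedding
      (hD.isRowIsometry_toeplitzShift hd)).toContinuousLinearMap ∘L hD.outerFactor hd hu := by
  have he := hD.isUnitWandering hd hu
  have hV := hD.isRowIsometry_toeplitzShift hd
  let P : G →L[ℂ] G := (he.embedding hV).toContinuousLinearMap ∘L he.coembedding hV
  have P_residual : P (residual D) = residual D := by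
    have h0 : ((‖residual D‖⁻¹ : ℝ) : ℂ) ≠ 0 := by simpa using hu
    have h := he.embedding_coembedding_self hV
    simp only [map_smul] at h
    exact smul_right_injective G h0 h
  have commutes : CommutesWithShifts (N ∘L D - N ∘L P ∘L D) := fun k h => by
    simp only [P, sub_apply, ContinuousLinearMap.comp_apply, map_sub,
      LinearIsometry.coe_toContinuousLinearMap, ← hD.toeplitzShift_apply hd, (hN k).eq,
      he.coembedding_apply_apply, he.embedding_leftShift]
  have residual_eq_zero : residual (N ∘L D - N ∘L P ∘L D) = 0 :=
    residual_eq_zero_of_comp_eq (D := D) (N := N - N ∘L P) rfl (by simp [P_residual])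
  exact sub_eq_zero.1 (commutes.eq_zero_of_residual_eq_zero residual_eq_zero)

theorem norm_apply_le_norm_outerFactor {S : Fock ι →L[ℂ] Fock ι} (hS : CommutesWithShifts S)
    (hSD : ∀ h, ‖S h‖ ≤ ‖D h‖) (h : Fock ι) : ‖S h‖ ≤ ‖hD.outerFactor hd hu h‖ := by
  obtain ⟨N, hND, norm_N, hN⟩ := hD.exists_comp_eq hd hS hSD
  let J := (hD.isUnitWandering hd hu).embedding (hD.isRowIsometry_toeplitzShift hd)
  calc ‖S h‖ = ‖N (J (hD.outerFactor hd hu h))‖ :=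
        congr(‖$(hND.symm.trans (hD.comp_eq_comp_embedding_comp_outerFactor hd hu hN)) h‖)
    _ ≤ ‖J (hD.outerFactor hd hu h)‖ := norm_N _
    _ = ‖hD.outerFactor hd hu h‖ := J.norm_map _

theorem residual_eq_zero_of_norm_sq_outerFactor_add_le {D' : Fock ι →L[ℂ] H}
    (h : ∀ x, ‖hD.outerFactor hd hu x‖ ^ 2 + ‖D' x‖ ^ 2 ≤ ‖D x‖ ^ 2) : residual D' = 0 := by
  have hle : ‖residual D‖ ^ 2 + ‖residual D'‖ ^ 2 ≤ ‖residual D‖ ^ 2 := by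
    refine le_norm_residual_sq fun p hp => (add_le_add ?_ ?_).trans (h (vacuum ι - p))
    · have h1 := norm_coeff_le (hD.outerFactor hd hu (vacuum ι - p)) []
      rw [outerFactor_apply_nil] at h1
      gcongr
      simpa [hp.2, vacuum_apply_nil] using h1
    · gcongr
      exact norm_residual_le D' (by simp [hp.2, vacuum_apply_nil])
  have h0 : ‖residual D'‖ ^ 2 ≤ 0 := by linarith
  simpa using h0.antisymm (sq_nonneg _)

end IsToeplitzFactor

end OuterFactor

section Multipliers

variable {ι : Type*}

theorem ncMul_reverse (f g : List ι → ℂ) (w : List ι) :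
    ncMul f g w.reverse = ncMul (fun v => g v.reverse) (fun v => f v.reverse) w := by
  rw [ncMul, ncMul, ← Finset.sum_range_reflect, List.length_reverse]
  refine Finset.sum_congr rfl fun n hn => ?_
  have hle : n ≤ w.length := Nat.lt_succ_iff.1 (Finset.mem_range.1 hn)
  have hsub : w.length + 1 - 1 - n = w.length - n := by lia
  rw [hsub, List.drop_reverse, List.take_reverse, Nat.sub_sub_self hle, mul_comm]

theorem flip_flip (h : Fock ι) : flip (flip h) = h := by
  ext w
  exact congrArg h w.reverse_reverse

theorem norm_flip (h : Fock ι) : ‖flip h‖ = ‖h‖ := by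
  have opNorm_flip_le : ‖(flip : Fock ι →L[ℂ] Fock ι)‖ ≤ 1 := by
    unfold flip compOp
    exact LinearMap.mkContinuous_norm_le _ zero_le_one _
  have norm_flip_le := (opNorm_le_one_iff flip).1 opNorm_flip_le
  refine (norm_flip_le h).antisymm ?_
  simpa only [flip_flip] using norm_flip_le (flip h)

theorem opNorm_comp_flip {E : Type*} [NormedAddCommGroup E] [NormedSpace ℂ E]
    (T : Fock ι →L[ℂ] E) : ‖T ∘L flip‖ = ‖T‖ := by
  let e : Fock ι ≃ₗᵢ[ℂ] Fock ι :=
    { LinearEquiv.ofInvolutive (flip (ι := ι) : Fock ι →ₗ[ℂ] Fock ι) flip_flip with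
      norm_map' := norm_flip }
  exact T.opNorm_comp_linearIsometryEquiv e

theorem CommutesWithShifts.semiconj_adjoint {S : Fock ι →L[ℂ] Fock ι} (hS : CommutesWithShifts S)
    (k : ι) : Function.Semiconj (S†) ((leftShift k)†) ((leftShift k)†) := fun h =>
  ext_inner_right ℂ fun x => by
    simp only [ContinuousLinearMap.adjoint_inner_left, (hS k).eq]

namespace Hinf

theorem coeff_eq_opR_vacuum (F : Hinf ι) (w : List ι) : F.coeff w = F.opR (vacuum ι) w.reverse := by
  rw [← transpose, transpose_apply, List.reverse_reverse]

theorem ext_coeff {F G : Hinf ι} (h : ∀ w, F.coeff w = G.coeff w) : F = G := by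
  obtain ⟨f, A, hA⟩ := F
  obtain ⟨g, B, hB⟩ := G
  obtain rfl : f = g := funext h
  obtain rfl : A = B := by
    ext x w
    rw [hA, hB]
  rfl

theorem opNorm_opR (F : Hinf ι) : ‖F.opR‖ = ‖F.opL‖ := by
  rw [← opNorm_comp_flip F.opL]
  exact ContinuousLinearMap.opNorm_ext _ _ fun h => norm_flip _

theorem commutesWithShifts_opR (F : Hinf ι) : CommutesWithShifts F.opR := by
  classical
  intro k h
  ext w
  rw [opR_apply]
  cases w with
  | nil => simp [ncMul, leftShift_nil]
  | cons j w =>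
    have coeff_cons (g : Fock ι) : (fun v => leftShift k g (j :: v)) = if j = k then ⇑g else 0 := by
      simp only [← adjoint_leftShift_apply, adjoint_leftShift_leftShift]
      split_ifs <;> rfl
    rw [ncMul_cons, leftShift_nil, zero_mul, zero_add, coeff_cons, congrFun (coeff_cons _) w]
    split_ifs
    · rw [opR_apply]
    · simp [ncMul]

/-- The multiplier `F` for which `F(R)` is a given operator that commutes with the left shifts. -/
def ofCommutes {S : Fock ι →L[ℂ] Fock ι} (hS : CommutesWithShifts S) : Hinf ι where
  coeff w := S (vacuum ι) w.reverse
  opL := flip ∘L S ∘L flip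
  opL_apply h w := by
    refine (hS.apply_eq_ncMul (flip h) w.reverse).trans ((ncMul_reverse _ _ w).trans ?_)
    congr 1
    exact congrArg (fun g : Fock ι => (g : List ι → ℂ)) (flip_flip h)

theorem opR_ofCommutes {S : Fock ι →L[ℂ] Fock ι} (hS : CommutesWithShifts S) :
    (ofCommutes hS).opR = S := by
  ext1 h
  exact (flip_flip _).trans (congrArg S (flip_flip h))

end Hinf

end Multipliers

section Columns

variable {ι κ : Type*} [Fintype κ]

theorem norm_sq_column_apply (T : κ → Fock ι →L[ℂ] Fock ι) (h : Fock ι) :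
    ‖column T h‖ ^ 2 = ∑ j, ‖T j h‖ ^ 2 :=
  PiLp.norm_sq_eq_of_L2 _ _

theorem inner_column_apply (T : κ → Fock ι →L[ℂ] Fock ι) (g h : Fock ι) :
    ⟪column T g, column T h⟫_ℂ = ∑ j, ⟪T j g, T j h⟫_ℂ :=
  PiLp.inner_apply _ _

theorem adjoint_column_apply (T : κ → Fock ι →L[ℂ] Fock ι) (f : PiLp 2 fun _ : κ => Fock ι) :
    ((column T)†) f = ∑ j, ((T j)†) (f j) :=
  ext_inner_right ℂ fun h => by
    simp only [ContinuousLinearMap.adjoint_inner_left, PiLp.inner_apply, column_apply, sum_inner]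

theorem opNorm_column_le_one_iff (T : κ → Fock ι →L[ℂ] Fock ι) :
    ‖column T‖ ≤ 1 ↔ ∀ h, ∑ j, ‖T j h‖ ^ 2 ≤ ‖h‖ ^ 2 := by
  simp only [opNorm_le_one_iff, ← norm_sq_column_apply, sq_le_sq₀ (norm_nonneg _) (norm_nonneg _)]

theorem isToeplitzFactor_column {T : κ → Fock ι →L[ℂ] Fock ι} (hT : ∀ j, IsToeplitzFactor (T j)) :
    IsToeplitzFactor (column T) where
  norm_apply k h := (sq_eq_sq₀ (norm_nonneg _) (norm_nonneg _)).1 <| by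
    simp only [norm_sq_column_apply, (hT _).norm_apply]
  inner_eq_zero j k hjk g h := by
    simp only [inner_column_apply, (hT _).inner_eq_zero hjk, Finset.sum_const_zero]

theorem opNorm_colR (c : κ → Hinf ι) : ‖colR c‖ = ‖colL c‖ := by
  rw [← opNorm_comp_flip (colL c)]
  refine ContinuousLinearMap.opNorm_ext _ _ fun h => ?_
  rw [← sq_eq_sq₀ (norm_nonneg _) (norm_nonneg _), colR, norm_sq_column_apply]
  refine Eq.trans ?_ (norm_sq_column_apply (fun j => (c j).opL) (flip h)).symm
  exact Finset.sum_congr rfl fun j _ => congrArg (· ^ 2) (norm_flip _)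

theorem opNorm_colL_le_one_iff (c : κ → Hinf ι) :
    ‖colL c‖ ≤ 1 ↔ ∀ h, ∑ j, ‖(c j).opR h‖ ^ 2 ≤ ‖h‖ ^ 2 := by
  rw [← opNorm_colR, colR, opNorm_column_le_one_iff]

end Columns

section BackwardShifts

variable {ι G H : Type*} [NormedAddCommGroup G] [InnerProductSpace ℂ G] [CompleteSpace G]
  [NormedAddCommGroup H] [InnerProductSpace ℂ H] [CompleteSpace H]

theorem exists_lp_incl_eq {T : Fock ι →L[ℂ] H} {D : Fock ι →L[ℂ] G} (hD : IsDefect T D)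
    (hT : IsToeplitzFactor T) {f : ι → H} {s : ℝ}
    (hf : ∀ k, (T†) (f k) = ((leftShift k)†) ((T†) (T (vacuum ι))))
    (hs : HasSum (fun k => ‖f k‖ ^ 2) s) :
    ∃ F : lp (fun _ : ι => ComplementarySpace T) 2, (∀ k, OperatorRange.incl _ (F k) = f k) ∧
      ‖F‖ ^ 2 = s + ‖D (vacuum ι)‖ ^ 2 - ‖residual D‖ ^ 2 := by
  have hDT := hD.isToeplitzFactor hT
  have adjoint_eq (k : ι) : (T†) (f k) = (D†) (-((toeplitzShift D k)†) (D (vacuum ι))) := by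
    rw [hf, map_neg, ← hDT.adjoint_leftShift_adjoint_apply hD.denseRange,
      hD.adjoint_apply_apply, map_sub, adjoint_leftShift_vacuum, zero_sub, neg_neg]
  choose F hF using fun k => hD.exists_incl_eq (adjoint_eq k)
  have norm_sq_eq (k : ι) :
      ‖F k‖ ^ 2 = ‖f k‖ ^ 2 + ‖((toeplitzShift D k)†) (D (vacuum ι))‖ ^ 2 := by
    rw [hD.norm_sq_eq_of_adjoint_incl_eq ((congrArg _ (hF k)).trans (adjoint_eq k)), hF, norm_neg]
  have hsum : HasSum (fun k => ‖F k‖ ^ 2) (s + (‖D (vacuum ι)‖ ^ 2 - ‖residual D‖ ^ 2)) := by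
    simp only [norm_sq_eq]
    exact hs.add (hDT.hasSum_norm_sq_adjoint_toeplitzShift hD.denseRange)
  have hmem : Memℓp F 2 := memℓp_gen (by simpa using hsum.summable)
  refine ⟨⟨F, hmem⟩, hF, ?_⟩
  have hnorm := lp.hasSum_norm (p := 2) (by norm_num)
    (⟨F, hmem⟩ : lp (fun _ : ι => ComplementarySpace T) 2)
  simp only [ENNReal.toReal_ofNat, Real.rpow_ofNat] at hnorm
  rw [hnorm.unique hsum, add_sub_assoc]

theorem hasSum_norm_sq_adjoint_leftShift_transpose (b : Hinf ι) :
    HasSum (fun k => ‖((leftShift k)†) b.transpose‖ ^ 2)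
      (‖b.opR (vacuum ι)‖ ^ 2 - ‖b.coeff []‖ ^ 2) := by
  have h := hasSum_norm_sq_adjoint_leftShift b.transpose
  rwa [Hinf.transpose_apply] at h

theorem exists_isBackwardShift {b : Hinf ι} {D : Fock ι →L[ℂ] G} (hD : IsDefect b.opR D) :
    ∃ bb : lp (fun _ : ι => Ht b) 2, IsBackwardShift b bb ∧
      ‖bb‖ ^ 2 = 1 - ‖b.coeff []‖ ^ 2 - ‖residual D‖ ^ 2 := by
  obtain ⟨bb, incl_eq, norm_sq_eq⟩ := exists_lp_incl_eq hD
    b.commutesWithShifts_opR.isToeplitzFactor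
    (fun k => (b.commutesWithShifts_opR.semiconj_adjoint k).eq _)
    (hasSum_norm_sq_adjoint_leftShift_transpose b)
  refine ⟨bb, incl_eq, ?_⟩
  rw [norm_sq_eq, hD.norm_sq_apply, norm_vacuum]
  ring

theorem exists_isBackwardShiftCol {κ : Type*} [Fintype κ] {c : κ → Hinf ι} {D : Fock ι →L[ℂ] G}
    (hD : IsDefect (colR c) D) :
    ∃ cc : lp (fun _ : ι => HtCol c) 2, IsBackwardShiftCol c cc ∧
      ‖cc‖ ^ 2 = 1 - ∑ j, ‖(c j).coeff []‖ ^ 2 - ‖residual D‖ ^ 2 := by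
  let f (k : ι) : PiLp 2 fun _ : κ => Fock ι :=
    WithLp.toLp 2 fun j => ((leftShift k)†) (c j).transpose
  have adjoint_eq (k : ι) :
      ((colR c)†) (f k) = ((leftShift k)†) (((colR c)†) (colR c (vacuum ι))) := by
    rw [colR, adjoint_column_apply, adjoint_column_apply, map_sum]
    exact Finset.sum_congr rfl fun j _ => ((c j).commutesWithShifts_opR.semiconj_adjoint k).eq _
  have hs : HasSum (fun k => ‖f k‖ ^ 2)
      (‖colR c (vacuum ι)‖ ^ 2 - ∑ j, ‖(c j).coeff []‖ ^ 2) := by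
    simp only [PiLp.norm_sq_eq_of_L2, ← Finset.sum_sub_distrib]
    exact hasSum_sum fun j _ => hasSum_norm_sq_adjoint_leftShift_transpose (c j)
  obtain ⟨cc, incl_eq, norm_sq_eq⟩ := exists_lp_incl_eq hD
    (isToeplitzFactor_column fun j => (c j).commutesWithShifts_opR.isToeplitzFactor) adjoint_eq hs
  refine ⟨cc, fun k j => congr($(incl_eq k) j), ?_⟩
  rw [norm_sq_eq, hD.norm_sq_apply, norm_vacuum]
  ring

end BackwardShifts

section SarasonFunction

variable {ι G : Type*} [NormedAddCommGroup G] [InnerProductSpace ℂ G] [CompleteSpace G]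
  {b : Hinf ι} {D : Fock ι →L[ℂ] G}

theorem IsSarasonFunction.unique {a a' : Hinf ι} (h : IsSarasonFunction b a)
    (h' : IsSarasonFunction b a') : a = a' := by
  obtain ⟨X, bt, bb, hX, hbt, hbb, -, coeff_nil, coeff_eq⟩ := h
  obtain ⟨X', bt', bb', hX', hbt', hbb', -, coeff_nil', coeff_eq'⟩ := h'
  have incl_injective : Function.Injective (Ht.incl b) := OperatorRange.incl_injective _
  obtain rfl : X = X' := by
    funext k
    ext1 f
    exact incl_injective ((hX k f).trans (hX' k f).symm)
  obtain rfl : bt = bt' := incl_injective (hbt.trans hbt'.symm)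
  obtain rfl : bb = bb' := by
    ext1
    funext k
    exact incl_injective ((hbb k).trans (hbb' k).symm)
  have coeff_nil_eq : a.coeff [] = a'.coeff [] := coeff_nil.trans coeff_nil'.symm
  refine Hinf.ext_coeff fun w => ?_
  obtain rfl | hw := eq_or_ne w []
  · exact coeff_nil_eq
  · rw [coeff_eq w hw, coeff_eq' w hw, coeff_nil_eq]

theorem residual_ne_zero_of_not_isColumnExtreme (hD : IsDefect b.opR D)
    (hCE : ¬ IsColumnExtreme b) : residual D ≠ 0 := by
  intro h0
  refine hCE ⟨b.opNorm_opR ▸ hD.opNorm_le_one, fun f hf w => ?_⟩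
  have norm_le (h : Fock ι) : ‖f.opR h‖ ≤ ‖D h‖ := by
    have hle := (opNorm_colL_le_one_iff _).1 hf h
    simp only [Fin.sum_univ_two, Matrix.cons_val_zero, Matrix.cons_val_one] at hle
    refine le_of_sq_le_sq ?_ (norm_nonneg _)
    linarith [hD.norm_sq_apply h]
  have residual_le : ‖residual f.opR‖ ^ 2 ≤ ‖residual D‖ ^ 2 := le_norm_residual_sq fun p hp => by
    gcongr
    exact (norm_residual_le _ (by simp [hp.2, vacuum_apply_nil])).trans (norm_le _)
  have residual_eq_zero : residual f.opR = 0 := by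
    rw [h0, norm_zero, zero_pow two_ne_zero] at residual_le
    simpa using residual_le.antisymm (sq_nonneg _)
  rw [f.coeff_eq_opR_vacuum, f.commutesWithShifts_opR.eq_zero_of_residual_eq_zero residual_eq_zero]
  rfl

theorem IsDefect.isToeplitzFactor_opR (hD : IsDefect b.opR D) : IsToeplitzFactor D :=
  hD.isToeplitzFactor b.commutesWithShifts_opR.isToeplitzFactor

theorem IsDefect.adjoint_opR_adjoint_leftShift_eq (hD : IsDefect b.opR D) (k : ι) {f : Fock ι}
    {z : G} (hz : (b.opR†) f = (D†) z) :
    (b.opR†) (((leftShift k)†) f) = (D†) (((toeplitzShift D k)†) z) := by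
  rw [(b.commutesWithShifts_opR.semiconj_adjoint k).eq, hz,
    hD.isToeplitzFactor_opR.adjoint_leftShift_adjoint_apply hD.denseRange]

theorem IsDefect.adjoint_opR_incl_prod_map_eq (hD : IsDefect b.opR D) {X : ι → Ht b →L[ℂ] Ht b}
    (hX : ∀ k f, Ht.incl b (X k f) = ((leftShift k)†) (Ht.incl b f)) {f : Ht b} {z : G}
    (hz : (b.opR†) (Ht.incl b f) = (D†) z) (w : List ι) :
    (b.opR†) (Ht.incl b ((w.map X).prod f)) =
      (D†) ((w.map fun k => (toeplitzShift D k)†).prod z) := by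
  induction w with
  | nil => exact hz
  | cons k w ih =>
    rw [List.map_cons, List.map_cons, List.prod_cons, List.prod_cons, mul_apply_eq_comp,
      mul_apply_eq_comp, hX, hD.adjoint_opR_adjoint_leftShift_eq k ih]

theorem IsDefect.adjoint_opR_transpose_eq (hD : IsDefect b.opR D) (hu : residual D ≠ 0) :
    (b.opR†) b.transpose =
      (D†) ((((‖residual D‖ ^ 2)⁻¹ : ℝ) : ℂ) • residual D - D (vacuum ι)) := by
  have h0 : ‖residual D‖ ^ 2 ≠ 0 := by simpa using hu
  rw [map_sub, map_smul, adjoint_apply_residual, smul_smul, ← Complex.ofReal_mul,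
    inv_mul_cancel₀ h0, Complex.ofReal_one, one_smul, hD.adjoint_apply_apply, sub_sub_cancel,
    Hinf.transpose]

theorem IsDefect.inner_eq_inner_residual (hD : IsDefect b.opR D) (hu : residual D ≠ 0)
    {bt f : Ht b} (hbt : Ht.incl b bt = b.transpose) {z : G}
    (hz : (b.opR†) (Ht.incl b f) = (D†) z) :
    ⟪bt, f⟫_ℂ = ((‖residual D‖ ^ 2)⁻¹ : ℝ) * ⟪residual D, z⟫_ℂ := by
  have inner_incl : ⟪Ht.incl b bt, Ht.incl b f⟫_ℂ = ⟪D (vacuum ι), z⟫_ℂ := by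
    rw [hbt, Hinf.transpose, ← ContinuousLinearMap.adjoint_inner_right, hz,
      ContinuousLinearMap.adjoint_inner_right]
  rw [hD.inner_eq_of_adjoint_incl_eq ((congrArg _ hbt).trans (hD.adjoint_opR_transpose_eq hu)) hz,
    inner_incl, inner_sub_left, add_sub_cancel, inner_smul_left, Complex.conj_ofReal]

theorem IsDefect.inner_transpose_prod_map (hD : IsDefect b.opR D) (hu : residual D ≠ 0)
    {X : ι → Ht b →L[ℂ] Ht b} (hX : ∀ k f, Ht.incl b (X k f) = ((leftShift k)†) (Ht.incl b f))
    {bt : Ht b} (hbt : Ht.incl b bt = b.transpose) {w : List ι} (hw : w ≠ []) :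
    ⟪bt, (w.map X).prod bt⟫_ℂ = -(((‖residual D‖ ^ 2)⁻¹ : ℝ) *
      ⟪(w.reverse.map (toeplitzShift D)).prod (residual D), D (vacuum ι)⟫_ℂ) := by
  have adjoint_prod : (w.map fun k => (toeplitzShift D k)†).prod =
      (w.reverse.map (toeplitzShift D)).prod† := by
    rw [adjoint_prod_map, List.reverse_reverse]
  have hbt' := (congrArg _ hbt).trans (hD.adjoint_opR_transpose_eq hu)
  rw [hD.inner_eq_inner_residual hu hbt (hD.adjoint_opR_incl_prod_map_eq hX hbt' w), adjoint_prod,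
    ContinuousLinearMap.adjoint_inner_right, inner_sub_right, inner_smul_right,
    hD.isToeplitzFactor_opR.inner_prod_map_toeplitzShift_residual hD.denseRange
      (List.reverse_ne_nil_iff.2 hw), mul_zero, zero_sub, mul_neg]

/-- The multiplier `a` for which `a(R)` is the outer factor of the defect operator `D` of `b(R)`.
It is the Sarason function of `b`, see `isSarasonFunction_sarason`. -/
def sarason (hD : IsDefect b.opR D) (hu : residual D ≠ 0) : Hinf ι :=
  .ofCommutes (hD.isToeplitzFactor_opR.commutesWithShifts_outerFactor hD.denseRange hu)

variable (hD : IsDefect b.opR D) (hu : residual D ≠ 0)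

theorem opR_sarason :
    (sarason hD hu).opR = hD.isToeplitzFactor_opR.outerFactor hD.denseRange hu :=
  Hinf.opR_ofCommutes _

theorem coeff_sarason (w : List ι) : (sarason hD hu).coeff w = (‖residual D‖⁻¹ : ℝ) *
    ⟪(w.reverse.map (toeplitzShift D)).prod (residual D), D (vacuum ι)⟫_ℂ := by
  rw [Hinf.coeff_eq_opR_vacuum, opR_sarason, IsToeplitzFactor.outerFactor_apply]

theorem coeff_sarason_nil : (sarason hD hu).coeff [] = ‖residual D‖ := by
  rw [Hinf.coeff_eq_opR_vacuum, opR_sarason, List.reverse_nil,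
    IsToeplitzFactor.outerFactor_apply_nil, vacuum_apply_nil, mul_one]

theorem isSarasonFunction_sarason : IsSarasonFunction b (sarason hD hu) := by
  have h0 : (‖residual D‖ : ℂ) ≠ 0 := by simpa using hu
  choose X hX using fun k => hD.exists_restrict _ _ fun f z hz =>
    hD.adjoint_opR_adjoint_leftShift_eq k hz
  obtain ⟨bt, hbt⟩ := hD.exists_incl_eq (hD.adjoint_opR_transpose_eq hu)
  obtain ⟨bb, hbb, norm_sq_bb⟩ := exists_isBackwardShift hD
  have sub_eq : 1 - ‖b.coeff []‖ ^ 2 - ‖bb‖ ^ 2 = ‖residual D‖ ^ 2 := by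
    rw [norm_sq_bb, sub_sub_cancel]
  refine ⟨X, bt, bb, hX, hbt, hbb, ?_, ?_, fun w hw => ?_⟩
  · rw [sub_eq]
    positivity
  · rw [sub_eq, Real.sqrt_sq (norm_nonneg _), coeff_sarason_nil]
  · rw [coeff_sarason_nil, coeff_sarason, hD.inner_transpose_prod_map hu hX hbt hw]
    push_cast
    field_simp

theorem isOuter_sarason : (sarason hD hu).IsOuter := by
  rw [Hinf.IsOuter, opR_sarason]
  exact hD.isToeplitzFactor_opR.denseRange_outerFactor hD.denseRange hu

theorem norm_opR_sarason_apply_le (h : Fock ι) : ‖(sarason hD hu).opR h‖ ≤ ‖D h‖ := by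
  rw [opR_sarason]
  exact IsToeplitzFactor.norm_outerFactor_apply_le ..

theorem opNorm_sarason_le_one : ‖(sarason hD hu).opL‖ ≤ 1 := by
  rw [← Hinf.opNorm_opR, opNorm_le_one_iff]
  refine fun h => (norm_opR_sarason_apply_le hD hu h).trans (le_of_sq_le_sq ?_ (norm_nonneg _))
  linarith [hD.norm_sq_apply h, sq_nonneg ‖b.opR h‖]

theorem isMaximalFactorizableMinorant_sarason :
    IsMaximalFactorizableMinorant (1 - b.opR† ∘L b.opR)
      ((sarason hD hu).opR† ∘L (sarason hD hu).opR) := by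
  rw [← hD.adjoint_comp_self]
  refine ⟨⟨⟨_, rfl⟩, (adjoint_comp_self_le_iff _ _).2 (norm_opR_sarason_apply_le hD hu)⟩, ?_⟩
  rintro _ ⟨⟨f, rfl⟩, hf⟩
  rw [adjoint_comp_self_le_iff] at hf ⊢
  rw [opR_sarason]
  exact IsToeplitzFactor.norm_apply_le_norm_outerFactor _ _ _ f.commutesWithShifts_opR hf

theorem isGLB_norm_sq_coeff_sarason :
    IsGLB {r : ℝ | ∃ p : Fock ι, IsFreePolynomial p ∧ p [] = 0 ∧
        r = (⟪vacuum ι - p, (1 - b.opR† ∘L b.opR) (vacuum ι - p)⟫_ℂ).re}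
      (‖(sarason hD hu).coeff []‖ ^ 2) := by
  simp only [← hD.adjoint_comp_self, inner_adjoint_comp_self_apply, Complex.ofReal_re,
    coeff_sarason_nil, Complex.norm_real, norm_norm]
  exact isGLB_norm_residual_sq D

theorem norm_sq_colR_cons_sarason (h : Fock ι) :
    ‖colR ![b, sarason hD hu] h‖ ^ 2 = ‖b.opR h‖ ^ 2 + ‖(sarason hD hu).opR h‖ ^ 2 := by
  rw [colR, norm_sq_column_apply]
  exact Fin.sum_univ_two _

theorem opNorm_colR_cons_sarason_le_one : ‖colR ![b, sarason hD hu]‖ ≤ 1 := by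
  refine (opNorm_le_one_iff _).2 fun h => le_of_sq_le_sq ?_ (norm_nonneg _)
  have h1 : ‖(sarason hD hu).opR h‖ ^ 2 ≤ ‖D h‖ ^ 2 := by
    gcongr
    exact norm_opR_sarason_apply_le hD hu h
  rw [norm_sq_colR_cons_sarason]
  linarith [hD.norm_sq_apply h]

theorem residual_eq_zero_of_norm_sq_colR_add_le {H : Type*} [NormedAddCommGroup H]
    [InnerProductSpace ℂ H] [CompleteSpace H] {D' : Fock ι →L[ℂ] H}
    (h : ∀ x, ‖colR ![b, sarason hD hu] x‖ ^ 2 + ‖D' x‖ ^ 2 ≤ ‖x‖ ^ 2) : residual D' = 0 := by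
  refine hD.isToeplitzFactor_opR.residual_eq_zero_of_norm_sq_outerFactor_add_le hD.denseRange hu
    fun x => ?_
  rw [← opR_sarason hD hu, hD.norm_sq_apply]
  linarith [h x, norm_sq_colR_cons_sarason hD hu x]

theorem isColumnExtremeCol_cons_sarason : IsColumnExtremeCol ![b, sarason hD hu] := by
  refine ⟨(opNorm_colR _).symm.trans_le (opNorm_colR_cons_sarason_le_one hD hu), fun f hf j w => ?_⟩
  have residual_eq_zero : residual (f j).opR = 0 :=
    residual_eq_zero_of_norm_sq_colR_add_le hD hu fun x => by
      have hle := (opNorm_colL_le_one_iff _).1 hf x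
      rw [Fintype.sum_sum_type] at hle
      have single_le := Finset.single_le_sum (f := fun i => ‖(f i).opR x‖ ^ 2)
        (fun i _ => sq_nonneg _) (Finset.mem_univ j)
      rw [colR, norm_sq_column_apply]
      exact (add_le_add_right single_le _).trans hle
  rw [Hinf.coeff_eq_opR_vacuum,
    (f j).commutesWithShifts_opR.eq_zero_of_residual_eq_zero residual_eq_zero]
  rfl

theorem exists_isBackwardShift_norm_eq :
    ∃ (bb : lp (fun _ : ι => Ht b) 2) (cc : lp (fun _ : ι => HtCol ![b, sarason hD hu]) 2),
      IsBackwardShift b bb ∧ IsBackwardShiftCol ![b, sarason hD hu] cc ∧ ‖cc‖ = ‖bb‖ := by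
  have hD' := isDefect_defect (opNorm_colR_cons_sarason_le_one hD hu)
  obtain ⟨bb, hbb, norm_sq_bb⟩ := exists_isBackwardShift hD
  obtain ⟨cc, hcc, norm_sq_cc⟩ := exists_isBackwardShiftCol hD'
  refine ⟨bb, cc, hbb, hcc, (sq_eq_sq₀ (norm_nonneg _) (norm_nonneg _)).1 ?_⟩
  have residual_eq_zero := residual_eq_zero_of_norm_sq_colR_add_le hD hu
    fun x => (congrArg _ (hD'.norm_sq_apply x)).trans_le (add_sub_cancel _ _).le
  rw [norm_sq_bb, norm_sq_cc, residual_eq_zero, norm_zero, zero_pow two_ne_zero, sub_zero,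
    Fin.sum_univ_two, Matrix.cons_val_zero, Matrix.cons_val_one, Matrix.cons_val_zero,
    coeff_sarason_nil, Complex.norm_real, norm_norm, sub_sub]

end SarasonFunction

end FreeSarason

end

open FreeSarason in
theorem mainTheorem3_general {ι : Type*} (b : Hinf ι) (hb : ‖b.opL‖ ≤ 1)
    (hCE : ¬ IsColumnExtreme b) :
    (∃! a : Hinf ι, IsSarasonFunction b a) ∧
    ∀ a : Hinf ι, IsSarasonFunction b a →
      ‖a.opL‖ ≤ 1 ∧
      a.IsOuter ∧
      IsMaximalFactorizableMinorant (1 - b.opR† ∘L b.opR) (a.opR† ∘L a.opR) ∧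
      IsGLB {r : ℝ | ∃ p : Fock ι, IsFreePolynomial p ∧ p [] = 0 ∧
          r = (inner ℂ (vacuum ι - p) ((1 - b.opR† ∘L b.opR) (vacuum ι - p))).re}
        (‖a.coeff []‖ ^ 2) ∧
      IsColumnExtremeCol ![b, a] ∧
      ∃ (bb : lp (fun _ : ι => Ht b) 2) (cc : lp (fun _ : ι => HtCol ![b, a]) 2),
        IsBackwardShift b bb ∧ IsBackwardShiftCol ![b, a] cc ∧ ‖cc‖ = ‖bb‖ := by
  have hD := isDefect_defect (b.opNorm_opR.trans_le hb)
  have hu := residual_ne_zero_of_not_isColumnExtreme hD hCE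
  have ha := isSarasonFunction_sarason hD hu
  refine ⟨⟨_, ha, fun a' ha' => ha'.unique ha⟩, fun a ha' => ?_⟩
  obtain rfl := ha'.unique ha
  exact ⟨opNorm_sarason_le_one hD hu, isOuter_sarason hD hu,
    isMaximalFactorizableMinorant_sarason hD hu, isGLB_norm_sq_coeff_sarason hD hu,
    isColumnExtremeCol_cons_sarason hD hu, exists_isBackwardShift_norm_eq hD hu⟩

open FreeSarason in
theorem mainTheorem3 {ι : Type*} [Countable ι] (b : Hinf ι) (hb : ‖b.opL‖ ≤ 1)
    (hCE : ¬ IsColumnExtreme b) :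
    (∃! a : Hinf ι, IsSarasonFunction b a) ∧
    ∀ a : Hinf ι, IsSarasonFunction b a →
      ‖a.opL‖ ≤ 1 ∧
      a.IsOuter ∧
      IsMaximalFactorizableMinorant (1 - b.opR† ∘L b.opR) (a.opR† ∘L a.opR) ∧
      IsGLB {r : ℝ | ∃ p : Fock ι, IsFreePolynomial p ∧ p [] = 0 ∧
          r = (inner ℂ (vacuum ι - p) ((1 - b.opR† ∘L b.opR) (vacuum ι - p))).re}
        (‖a.coeff []‖ ^ 2) ∧
      IsColumnExtremeCol ![b, a] ∧
      ∃ (bb : lp (fun _ : ι => Ht b) 2) (cc : lp (fun _ : ι => HtCol ![b, a]) 2),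
        IsBackwardShift b bb ∧ IsBackwardShiftCol ![b, a] cc ∧ ‖cc‖ = ‖bb‖ :=
  mainTheorem3_general b hb hCE
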